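/- A \emph{girale} is an algebra $\langle A,\vee,\wedge,\to,\cdot,\neg,1,!\rangle$ such that $\langle A,\vee,\wedge,\to,\cdot,1\rangle$ is a commutative residuated lattice, and, with $0:=\neg 1$, $\neg a=a\to 0$ and $(a\to 0)\to 0=a$ for all $a$, and $!1=1$, $!a\le a\wedge 1$, $!a\cdot !b=!(a\wedge b)$, $!!a=!a$ for all $a,b$. For a girale $\mathbf A$ let $!A=\{!a:a\in A\}$ and let $!\mathbf A=\langle !A,\vee,\wedge_!,\to_!,\bot,1\rangle$, where $u\wedge_! v=!(u\wedge v)$, $u\to_! v=!(u\to v)$ and the constant $\bot$ is $!0$. For a class $\mathsf K$ of girales let $\mathrm{Heyt}(\mathsf K)$ be the class of (isomorphic copies of) the algebras $!\mathbf A$ with $\mathbf A\in\mathsf K$. A girale $\mathbf A$ is \emph{Boolean} if $!\mathbf A$ is a Boolean algebra. $\mathsf V(\mathbf A)$ is the variety generated by $\mathbf A$. Let $\mathbf G_1$ be the two-element Boolean algebra with $1=\top$, $0=\bot$, $x\cdot y=x\wedge y$ and $!x=x$. For $n\ge 2$ let $\mathbf G_n$ be the lattice of height three with bottom $\bot$,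 top $\top$ and $n$ atoms, two of which are named $1$ and $0$, with $\neg\bot=\top$, $\neg\top=\bot$, $\neg 1=0$, $\neg 0=1$ and $\neg a=a$ for every other element $a$; with $\bot\cdot a=a\cdot\bot=\bot$, $1\cdot a=a\cdot 1=a$, $a\cdot a=0$ for $a\notin\{0,1,\bot,\top\}$, and $a\cdot b=\top$ otherwise; with $a\to b=\neg(a\cdot\neg b)$; and with $!1=!\top=1$ and $!a=\bot$ otherwise. Then: 1. For every $n\ge1$, $\mathbf G_n$ is a finite simple Boolean girale, $|G_n|=n+2$ if $n\ge2$, and $\mathsf V(\mathbf G_n)$ is a variety of girales all of whose members are Boolean girales. 2. For $n\ge2$ the subdirectly irreducible algebras in $\mathsf V(\mathbf G_n)$ are, up to isomorphism, exactly the $\mathbf G_m$ with $2\le m\le n$; the only subdirectly irreducible algebra in $\mathsf V(\mathbf G_1)$ is, up to isomorphism, $\mathbf G_1$. 3. If $m,n\ge 1$ and $m\ne n$, then $\mathbf G_m\not\cong\mathbf G_n$ and $\mathsf V(\mathbf G_m)\neq\mathsf V(\mathbf G_n)$. So there are infinitely many pairwise nonisomorphic finite simple girales, which generate pairwise distinct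 varieties. 4. $\mathsf V(\mathbf G_1)$ and $\mathsf V(\mathbf G_2)$ are atoms of the lattice of varieties, and $\mathsf V(\mathbf G_1)\cap\mathsf V(\mathbf G_2)$ is the trivial variety, so that $\mathrm{Heyt}(\mathsf V(\mathbf G_1)\cap\mathsf V(\mathbf G_2))$ is the class of one-element algebras. But $\mathrm{Heyt}(\mathsf V(\mathbf G_1))=\mathrm{Heyt}(\mathsf V(\mathbf G_2))$ is the variety of all Boolean algebras. Hence $\mathrm{Heyt}(\mathsf V(\mathbf G_1)\cap\mathsf V(\mathbf G_2))\ne\mathrm{Heyt}(\mathsf V(\mathbf G_1))\cap\mathrm{Heyt}(\mathsf V(\mathbf G_2))$, and $\mathrm{Heyt}$ is not a meet-homomorphism on varieties of girales. -/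

import Mathlib

universe u

namespace Girales

/-! ## Universal algebra -/

/-- A type of (finitary) algebras: operation symbols with their arities. -/
structure AlgType where
  Op : Type
  arity : Op → ℕ

/-- An algebra of type `σ`. -/
structure UAlg (σ : AlgType) : Type (u + 1) where
  carrier : Type u
  op : (f : σ.Op) → (Fin (σ.arity f) → carrier) → carrier

variable {σ : AlgType}

/-- Homomorphisms of algebras. -/
def IsHom (A B : UAlg.{u} σ) (φ : A.carrier → B.carrier) : Prop :=
  ∀ (f : σ.Op) (x : Fin (σ.arity f) → A.carrier), φ (A.op f x) = B.op f (fun i => φ (x i))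

/-- `A` and `B` are isomorphic. -/
def Iso (A B : UAlg.{u} σ) : Prop :=
  ∃ φ : A.carrier → B.carrier, IsHom A B φ ∧ Function.Bijective φ

/-- The direct product of a family of algebras. -/
def prodAlg {ι : Type u} (A : ι → UAlg.{u} σ) : UAlg.{u} σ where
  carrier := ∀ i, (A i).carrier
  op f x := fun i => (A i).op f (fun j => x j i)

/-- A class of algebras is a variety if it is closed under homomorphic images, under
(isomorphic copies of) subalgebras, and under direct products. -/
structure IsVariety (K : Set (UAlg.{u} σ)) : Prop where
  closed_H : ∀ A ∈ K, ∀ B : UAlg.{u} σ,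
    (∃ φ : A.carrier → B.carrier, IsHom A B φ ∧ Function.Surjective φ) → B ∈ K
  closed_S : ∀ A ∈ K, ∀ B : UAlg.{u} σ,
    (∃ φ : B.carrier → A.carrier, IsHom B A φ ∧ Function.Injective φ) → B ∈ K
  closed_P : ∀ (ι : Type u) (A : ι → UAlg.{u} σ), (∀ i, A i ∈ K) → prodAlg A ∈ K

/-- The variety generated by an algebra: the smallest variety containing it. -/
def V (A : UAlg.{u} σ) : Set (UAlg.{u} σ) :=
  {B | ∀ W : Set (UAlg.{u} σ), IsVariety W → A ∈ W → B ∈ W}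

/-- The trivial class (one-element algebras, if the type has a constant). -/
def trivialClass (σ : AlgType) : Set (UAlg.{u} σ) := {A | Subsingleton A.carrier}

/-- Atoms of the lattice of varieties: nontrivial varieties whose only proper subvariety is
the trivial one. -/
def IsAtomVariety (K : Set (UAlg.{u} σ)) : Prop :=
  IsVariety K ∧ K ≠ trivialClass σ ∧
    ∀ W : Set (UAlg.{u} σ), IsVariety W → W ⊆ K → W = trivialClass σ ∨ W = K

/-- Congruences of an algebra. -/
def IsCongruence (A : UAlg.{u} σ) (θ : Setoid A.carrier) : Prop :=
  ∀ (f : σ.Op) (x y : Fin (σ.arity f) → A.carrier), (∀ i, θ (x i) (y i)) → θ (A.op f x) (A.op f y)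

/-- An algebra is simple if it is nontrivial and has no congruences except the identity and the
total relation. -/
def IsSimpleAlg (A : UAlg.{u} σ) : Prop :=
  Nontrivial A.carrier ∧ ∀ θ : Setoid A.carrier, IsCongruence A θ → θ = ⊥ ∨ θ = ⊤

/-- An algebra is subdirectly irreducible if it has a least congruence among those different
from the identity. (One-element algebras are not subdirectly irreducible.) -/
def IsSubdirectlyIrreducible (A : UAlg.{u} σ) : Prop :=
  ∃ μ : Setoid A.carrier, IsCongruence A μ ∧ μ ≠ ⊥ ∧
    ∀ θ : Setoid A.carrier, IsCongruence A θ → θ ≠ ⊥ → μ ≤ θ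

/-! ## Girales -/

/-- The operation symbols of girales. -/
inductive GiraleOp
  | join | meet | imp | mul | neg | one | bang

/-- The type of girales. -/
def giraleType : AlgType where
  Op := GiraleOp
  arity f := match f with
    | .join => 2
    | .meet => 2
    | .imp => 2
    | .mul => 2
    | .neg => 1
    | .one => 0
    | .bang => 1

/-- The algebra of the type of girales with given operations. -/
def mkGiraleAlg (α : Type u) (join meet imp mul : α → α → α) (neg : α → α) (one : α)
    (bang : α → α) : UAlg.{u} giraleType where
  carrier := α
  op f := match f with
    | .join => fun x : Fin 2 → α => join (x 0) (x 1)
    | .meet => fun x : Fin 2 → α => meet (x 0) (x 1)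
    | .imp => fun x : Fin 2 → α => imp (x 0) (x 1)
    | .mul => fun x : Fin 2 → α => mul (x 0) (x 1)
    | .neg => fun x : Fin 1 → α => neg (x 0)
    | .one => fun _ => one
    | .bang => fun x : Fin 1 → α => bang (x 0)

section ops

variable (A : UAlg.{u} giraleType)

def join (a b : A.carrier) : A.carrier := A.op GiraleOp.join ![a, b]
def meet (a b : A.carrier) : A.carrier := A.op GiraleOp.meet ![a, b]
def imp (a b : A.carrier) : A.carrier := A.op GiraleOp.imp ![a, b]
def mul (a b : A.carrier) : A.carrier := A.op GiraleOp.mul ![a, b]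
def neg (a : A.carrier) : A.carrier := A.op GiraleOp.neg ![a]
def one : A.carrier := A.op GiraleOp.one ![]
def bang (a : A.carrier) : A.carrier := A.op GiraleOp.bang ![a]

/-- The constant `0 = ¬ 1`. -/
def zero : A.carrier := neg A (one A)

/-- The lattice order. -/
def le (a b : A.carrier) : Prop := meet A a b = a

/-- Girales: Girard algebras (commutative residuated lattices in which `0` is an involutive
element and `¬ a = a → 0`) with a unary operation `!` that satisfies `!1 = 1`, `!a ≤ a ∧ 1`,
`!a · !b = !(a ∧ b)` and `!!a = !a`. -/
structure IsGirale : Prop where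
  join_comm : ∀ a b, join A a b = join A b a
  join_assoc : ∀ a b c, join A (join A a b) c = join A a (join A b c)
  meet_comm : ∀ a b, meet A a b = meet A b a
  meet_assoc : ∀ a b c, meet A (meet A a b) c = meet A a (meet A b c)
  join_meet_self : ∀ a b, join A a (meet A a b) = a
  meet_join_self : ∀ a b, meet A a (join A a b) = a
  mul_comm : ∀ a b, mul A a b = mul A b a
  mul_assoc : ∀ a b c, mul A (mul A a b) c = mul A a (mul A b c)
  one_mul : ∀ a, mul A (one A) a = a
  residuation : ∀ a b c, le A (mul A a b) c ↔ le A a (imp A b c)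
  involutive : ∀ a, imp A (imp A a (zero A)) (zero A) = a
  neg_eq : ∀ a, neg A a = imp A a (zero A)
  bang_one : bang A (one A) = one A
  bang_le : ∀ a, le A (bang A a) (meet A a (one A))
  bang_mul_bang : ∀ a b, mul A (bang A a) (bang A b) = bang A (meet A a b)
  bang_bang : ∀ a, bang A (bang A a) = bang A a

variable {A}

/-- The image of `!` in a girale is closed under joins. -/
theorem IsGirale.bang_join_bang (h : IsGirale A) (a b : A.carrier) :
    bang A (join A (bang A a) (bang A b)) = join A (bang A a) (bang A b) := by
  have refl : ∀ x, le A x x := fun x => by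
    have h1 := h.meet_join_self x (meet A x x)
    rw [h.join_meet_self] at h1
    exact h1
  have trans : ∀ x y z, le A x y → le A y z → le A x z := fun x y z h1 h2 => by
    simp only [le] at *
    rw [← h1, h.meet_assoc, h2]
  have antisymm : ∀ x y, le A x y → le A y x → x = y := fun x y h1 h2 => by
    simp only [le] at *
    rw [← h1, h.meet_comm, h2]
  have left : ∀ x y, le A (meet A x y) x := fun x y => by
    have h2 : meet A x x = x := refl x
    simp only [le]
    rw [h.meet_comm, ← h.meet_assoc, h2]
  have right : ∀ x y, le A (meet A x y) y := fun x y => by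
    rw [h.meet_comm]; exact left y x
  have jl : ∀ x y, le A x (join A x y) := h.meet_join_self
  have jr : ∀ x y, le A y (join A x y) := fun x y => by
    rw [h.join_comm]; exact jl y x
  have le_iff : ∀ x y, le A x y → join A x y = y := fun x y h1 => by
    simp only [le] at h1
    rw [← h1, h.meet_comm, h.join_comm, h.join_meet_self]
  have jle : ∀ x y z, le A x z → le A y z → le A (join A x y) z := fun x y z h1 h2 => by
    have h3 : join A (join A x y) z = z := by
      rw [h.join_assoc, le_iff _ _ h2, le_iff _ _ h1]
    have h4 := h.meet_join_self (join A x y) z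
    rw [h3] at h4
    exact h4
  have mulmono : ∀ x y z, le A x y → le A (mul A x z) (mul A y z) := fun x y z h1 =>
    (h.residuation _ _ _).2 (trans _ _ _ h1 ((h.residuation _ _ _).1 (refl _)))
  have mono : ∀ x y, le A x y → le A (bang A x) (bang A y) := fun x y h1 => by
    have h2 := mulmono _ _ (bang A y) (trans _ _ _ (h.bang_le x) (right _ _))
    rw [h.one_mul, h.bang_mul_bang] at h2
    simp only [le] at h1
    rw [h1] at h2
    exact h2
  apply antisymm
  · exact trans _ _ _ (h.bang_le _) (left _ _)
  · apply jle
    · have h1 := mono _ _ (jl (bang A a) (bang A b))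
      rwa [h.bang_bang] at h1
    · have h1 := mono _ _ (jr (bang A a) (bang A b))
      rwa [h.bang_bang] at h1

end ops

/-! ## Heyting algebras and the operator `Heyt` -/

/-- The operation symbols of (pointed) Heyting algebras. -/
inductive HeytOp
  | join | meet | imp | bot | one

/-- The type of (pointed) Heyting algebras. -/
def heytType : AlgType where
  Op := HeytOp
  arity f := match f with
    | .join => 2
    | .meet => 2
    | .imp => 2
    | .bot => 0
    | .one => 0

/-- The algebra `!A = ⟨!A, ∨, ∧_!, →_!, ⊥, 1⟩` of a girale `A`, where `!A = {!a : a ∈ A}`,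
`u ∧_! v = !(u ∧ v)`, `u →_! v = !(u → v)`, and where the constant `⊥` is `!0`. -/
def bangAlg (A : UAlg.{u} giraleType) (h : IsGirale A) : UAlg.{u} heytType where
  carrier := {a : A.carrier // ∃ b, bang A b = a}
  op f := match f with
    | .join => fun x : Fin 2 → {a : A.carrier // ∃ b, bang A b = a} =>
        ⟨join A (x 0).1 (x 1).1, join A (x 0).1 (x 1).1, by
          obtain ⟨a, ha⟩ := (x 0).2
          obtain ⟨b, hb⟩ := (x 1).2
          rw [← ha, ← hb]
          exact h.bang_join_bang a b⟩
    | .meet => fun x : Fin 2 → {a : A.carrier // ∃ b, bang A b = a} =>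
        ⟨bang A (meet A (x 0).1 (x 1).1), _, rfl⟩
    | .imp => fun x : Fin 2 → {a : A.carrier // ∃ b, bang A b = a} =>
        ⟨bang A (imp A (x 0).1 (x 1).1), _, rfl⟩
    | .bot => fun _ => ⟨bang A (zero A), _, rfl⟩
    | .one => fun _ => ⟨one A, one A, h.bang_one⟩

section hops

variable (B : UAlg.{u} heytType)

def hjoin (a b : B.carrier) : B.carrier := B.op HeytOp.join ![a, b]
def hmeet (a b : B.carrier) : B.carrier := B.op HeytOp.meet ![a, b]
def himp (a b : B.carrier) : B.carrier := B.op HeytOp.imp ![a, b]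
def hbot : B.carrier := B.op HeytOp.bot ![]
def hone : B.carrier := B.op HeytOp.one ![]
def hle (a b : B.carrier) : Prop := hmeet B a b = a

/-- Heyting algebras: bounded lattices in which `→` is the residual of the meet. -/
structure IsHeyting : Prop where
  join_comm : ∀ a b, hjoin B a b = hjoin B b a
  join_assoc : ∀ a b c, hjoin B (hjoin B a b) c = hjoin B a (hjoin B b c)
  meet_comm : ∀ a b, hmeet B a b = hmeet B b a
  meet_assoc : ∀ a b c, hmeet B (hmeet B a b) c = hmeet B a (hmeet B b c)
  join_meet_self : ∀ a b, hjoin B a (hmeet B a b) = a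
  meet_join_self : ∀ a b, hmeet B a (hjoin B a b) = a
  bot_le : ∀ a, hle B (hbot B) a
  le_one : ∀ a, hle B a (hone B)
  residuation : ∀ a b c, hle B (hmeet B a b) c ↔ hle B a (himp B b c)

/-- Boolean algebras: Heyting algebras that satisfy `a ∨ (a → ⊥) = 1`. -/
def IsBooleanAlg : Prop :=
  IsHeyting B ∧ ∀ a, hjoin B a (himp B a (hbot B)) = hone B

end hops

/-- The class of Boolean algebras. -/
def BooleanAlgs : Set (UAlg.{u} heytType) := {B | IsBooleanAlg B}

/-- `Heyt(K)`: the algebras (isomorphic to) `!A`, for a girale `A` in `K`. -/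
def Heyt (K : Set (UAlg.{u} giraleType)) : Set (UAlg.{u} heytType) :=
  {B | ∃ A ∈ K, ∃ h : IsGirale A, Iso B (bangAlg A h)}

/-- Boolean girales: girales `A` for which `!A` is a Boolean algebra. -/
def IsBooleanGirale (A : UAlg.{u} giraleType) : Prop :=
  ∃ h : IsGirale A, IsBooleanAlg (bangAlg A h)

/-- Varieties of girales. -/
def IsGiraleVariety (K : Set (UAlg.{u} giraleType)) : Prop :=
  IsVariety K ∧ ∀ A ∈ K, IsGirale A

/-! ## The algebras `G n` -/

/-- The elements of the height-three lattice with the `k + 2` atoms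
`1`, `0` and `mid i` (`i < k`). -/
inductive GElt (k : ℕ) : Type u
  | bot | top | one | zero
  | mid (i : Fin k)
  deriving DecidableEq

namespace GElt

variable {k : ℕ}

/-- Two distinct elements, neither of which is the bottom, have join `⊤`. -/
def join (x y : GElt.{u} k) : GElt.{u} k :=
  if x = y then x else if x = bot then y else if y = bot then x else top

/-- Two distinct elements, neither of which is the top, have meet `⊥`. -/
def meet (x y : GElt.{u} k) : GElt.{u} k :=
  if x = y then x else if x = top then y else if y = top then x else bot

def neg : GElt.{u} k → GElt.{u} k
  | bot => top
  | top => bot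
  | one => zero
  | zero => one
  | mid i => mid i

def mul : GElt.{u} k → GElt.{u} k → GElt.{u} k
  | bot, _ => bot
  | _, bot => bot
  | one, y => y
  | x, one => x
  | mid i, mid j => if i = j then zero else top
  | _, _ => top

/-- `x → y = ¬ (x · ¬ y)`. -/
def imp (x y : GElt.{u} k) : GElt.{u} k := neg (mul x (neg y))

def bang : GElt.{u} k → GElt.{u} k
  | one => one
  | top => one
  | _ => bot

end GElt

/-- The two-element Boolean algebra, with `1 = ⊤`, `0 = ⊥`, `x · y = x ∧ y` and `!x = x`. -/
def twoAlg : UAlg.{u} giraleType :=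
  mkGiraleAlg (ULift.{u} Bool)
    (fun x y => ⟨x.down || y.down⟩) (fun x y => ⟨x.down && y.down⟩)
    (fun x y => ⟨!x.down || y.down⟩) (fun x y => ⟨x.down && y.down⟩)
    (fun x => ⟨!x.down⟩) ⟨true⟩ (fun x => x)

/-- The algebra `G n`, for `n ≥ 1`: the two-element Boolean algebra if `n = 1`, and the
height-three lattice with `n` atoms, with the operations above, if `n ≥ 2`.
(The value at `n = 0` is irrelevant.) -/
def G : ℕ → UAlg.{u} giraleType
  | k + 2 => mkGiraleAlg (GElt.{u} k) GElt.join GElt.meet GElt.imp GElt.mul GElt.neg GElt.one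
      GElt.bang
  | _ => twoAlg

end Girales

open Girales

/-! In every `G n` with `n ≥ 1` the operation `!` takes only the values `1` and `!0`, the element
`!0` is absorbing for multiplication, and `!((x → y) ∧ (y → x))` is `1` if `x = y` and `!0`
otherwise. So equality is decided by a term, much as in discriminator varieties;
`IsDiscriminatorGirale` records these properties, and most of the argument uses nothing else.

A congruence that identifies two distinct elements identifies `1` with `!0`, and then everything, by
multiplication. This applies to subalgebras too, so they are all simple. The same term shows that
the algebras separated by homomorphisms into `G` are closed under quotients (`SP_closed_H`), whence
`V G = SP G`. The subdirectly irreducible members of `V G` are therefore the subalgebras of `G` up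
to isomorphism. A subalgebra of `G n`, `n ≥ 2`, contains `⊥ = !0`, `⊤ = ¬!0`, `1` and `0`, so it is
determined by its further atoms and is a copy of some `G m`; cardinalities tell these apart.

`G 1` and `G 2` consist of values of constant terms, so each is an image of every nontrivial member
of the variety it generates: both varieties are atoms. The identity `¬!0 = 1` holds in `G 1` and
fails in `G 2`, so they meet trivially. Yet `Heyt` gives all Boolean algebras for both: `!` of the
Boolean power of `G` by a Boolean algebra `B` is `B`, by Stone duality (`iso_bangAlg_booleanPower`).
-/

namespace Girales

/-! ### Universal algebra: algebras separated by homomorphisms into a fixed algebra. -/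

variable {σ : AlgType}

theorem IsHom.comp {A B C : UAlg.{u} σ} {φ : A.carrier → B.carrier} {ψ : B.carrier → C.carrier}
    (hψ : IsHom B C ψ) (hφ : IsHom A B φ) : IsHom A C (fun x => ψ (φ x)) := fun f x => by
  show ψ (φ _) = _
  rw [hφ, hψ]

theorem isHom_proj {ι : Type u} (A : ι → UAlg.{u} σ) (i : ι) :
    IsHom (prodAlg A) (A i) (fun x => x i) := fun _ _ => rfl

theorem IsHom.of_comp_injective {A B C : UAlg.{u} σ} {φ : A.carrier → B.carrier}
    {ψ : B.carrier → C.carrier} (hψ : IsHom B C ψ) (inj : Function.Injective ψ)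
    (h : IsHom A C (fun x => ψ (φ x))) : IsHom A B φ := fun f x => inj (by
  rw [hψ]; exact h f x)

/-- Two embeddings with the same range have isomorphic domains. -/
theorem iso_of_range_eq {A B C : UAlg.{u} σ} {φ : A.carrier → C.carrier}
    {ψ : B.carrier → C.carrier} (hφ : IsHom A C φ) (iφ : Function.Injective φ)
    (hψ : IsHom B C ψ) (iψ : Function.Injective ψ) (hr : Set.range φ = Set.range ψ) :
    Iso A B := by
  have h1 : ∀ a, ∃ b, ψ b = φ a := fun a => by
    have : φ a ∈ Set.range ψ := hr ▸ ⟨a, rfl⟩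
    exact this
  choose χ hχ using h1
  refine ⟨χ, hψ.of_comp_injective iψ ?_, fun a a' h => iφ ?_, fun b => ?_⟩
  · simpa only [hχ] using hφ
  · rw [← hχ, ← hχ, h]
  · obtain ⟨a, ha⟩ : ψ b ∈ Set.range φ := hr ▸ ⟨b, rfl⟩
    exact ⟨a, iψ (by rw [hχ, ha])⟩

theorem isVariety_V (A : UAlg.{u} σ) : IsVariety (V A) where
  closed_H B hB C h W hW hA := hW.closed_H B (hB W hW hA) C h
  closed_S B hB C h W hW hA := hW.closed_S B (hB W hW hA) C h
  closed_P ι B hB W hW hA := hW.closed_P ι B fun i => hB i W hW hA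

theorem mem_V_self (A : UAlg.{u} σ) : A ∈ V A := fun _ _ h => h

theorem V_subset {A : UAlg.{u} σ} {W : Set (UAlg.{u} σ)} (hW : IsVariety W) (hA : A ∈ W) :
    V A ⊆ W := fun _ hB => hB W hW hA

theorem IsVariety.mem_of_iso {K : Set (UAlg.{u} σ)} (hK : IsVariety K) {A B : UAlg.{u} σ}
    (hB : B ∈ K) (h : Iso A B) : A ∈ K := by
  obtain ⟨φ, h1, h2⟩ := h
  exact hK.closed_S B hB A ⟨φ, h1, h2.1⟩

/-- A simple algebra is subdirectly irreducible. -/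
theorem IsSimpleAlg.isSubdirectlyIrreducible {A : UAlg.{u} σ} (h : IsSimpleAlg A) :
    IsSubdirectlyIrreducible A := by
  obtain ⟨⟨x, y, hxy⟩, h2⟩ := h
  refine ⟨⊤, fun _ _ _ _ => trivial, fun e => hxy ?_, fun θ hθ hne => ?_⟩
  · have : (⊤ : Setoid A.carrier) x y := trivial
    rw [e] at this
    exact this
  · rcases h2 θ hθ with h | h
    · exact absurd h hne
    · rw [h]

theorem isCongruence_ker {A B : UAlg.{u} σ} {φ : A.carrier → B.carrier} (h : IsHom A B φ) :
    IsCongruence A (Setoid.ker φ) := fun f x y hxy => by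
  show φ _ = φ _
  rw [h, h]
  congr 1
  funext i
  exact hxy i

/-- The algebras whose points are separated by homomorphisms into `G`. -/
def SP (G : UAlg.{u} σ) : Set (UAlg.{u} σ) :=
  {A | ∀ x y : A.carrier, (∀ h, IsHom A G h → h x = h y) → x = y}

theorem mem_SP_self (G : UAlg.{u} σ) : G ∈ SP G := fun _ _ h => h id fun _ _ => rfl

theorem SP_closed_S {G A B : UAlg.{u} σ} (hA : A ∈ SP G) {φ : B.carrier → A.carrier}
    (hφ : IsHom B A φ) (inj : Function.Injective φ) : B ∈ SP G := fun _ _ h =>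
  inj (hA _ _ fun _ hψ => h _ (hψ.comp hφ))

theorem SP_closed_P {G : UAlg.{u} σ} {ι : Type u} {A : ι → UAlg.{u} σ} (hA : ∀ i, A i ∈ SP G) :
    prodAlg A ∈ SP G := fun _ _ h =>
  funext fun i => hA i _ _ fun _ hψ => h _ (hψ.comp (isHom_proj A i))

/-- Evaluation embeds such an algebra into the power of `G` indexed by all its homomorphisms into
`G`. -/
theorem SP_subset_V (G : UAlg.{u} σ) : SP G ⊆ V G := fun A hA W hW hG => by
  refine hW.closed_S _ (hW.closed_P {h // IsHom A G h} (fun _ => G) fun _ => hG) A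
    ⟨fun a i => i.1 a, fun f x => funext fun i => i.2 f x, fun x y hxy => hA x y fun h hh => ?_⟩
  exact congrFun hxy ⟨h, hh⟩

theorem exists_hom_of_mem_SP {G A : UAlg.{u} σ} (hA : A ∈ SP G) {x y : A.carrier} (hxy : x ≠ y) :
    ∃ h, IsHom A G h ∧ h x ≠ h y := by
  by_contra! hc
  exact hxy (hA x y hc)

/-- A subdirectly irreducible algebra in `SP G` embeds into `G`. -/
theorem IsSubdirectlyIrreducible.exists_embedding {G A : UAlg.{u} σ} (hA : A ∈ SP G)
    (hs : IsSubdirectlyIrreducible A) : ∃ h, IsHom A G h ∧ Function.Injective h := by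
  obtain ⟨μ, _, hμ, hmin⟩ := hs
  -- If no homomorphism into `G` were injective, every kernel would contain the monolith `μ`; but
  -- the kernels intersect in the identity.
  by_contra! hc
  refine hμ (le_bot_iff.1 fun x y hxy => hA x y fun h hh => ?_)
  refine hmin (Setoid.ker h) (isCongruence_ker hh) (fun e => hc h hh fun a b hab => ?_) hxy
  have : Setoid.ker h a b := hab
  rw [e] at this
  exact this

theorem vec_two {α β : Type*} (φ : α → β) (a b : α) :
    (fun i : Fin 2 => φ (![a, b] i)) = ![φ a, φ b] := by
  funext i; fin_cases i <;> rfl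

/-! ### Transfer of the girale axioms and of the Boolean axioms. -/

section hom

variable {A B : UAlg.{u} giraleType} {φ : A.carrier → B.carrier} (h : IsHom A B φ)
include h

theorem IsHom.join (a b : A.carrier) : φ (join A a b) = join B (φ a) (φ b) :=
  (h GiraleOp.join ![a, b]).trans (congrArg (B.op GiraleOp.join) (vec_two φ a b))

theorem IsHom.meet (a b : A.carrier) : φ (meet A a b) = meet B (φ a) (φ b) :=
  (h GiraleOp.meet ![a, b]).trans (congrArg (B.op GiraleOp.meet) (vec_two φ a b))

theorem IsHom.imp (a b : A.carrier) : φ (imp A a b) = imp B (φ a) (φ b) :=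
  (h GiraleOp.imp ![a, b]).trans (congrArg (B.op GiraleOp.imp) (vec_two φ a b))

theorem IsHom.mul (a b : A.carrier) : φ (mul A a b) = mul B (φ a) (φ b) :=
  (h GiraleOp.mul ![a, b]).trans (congrArg (B.op GiraleOp.mul) (vec_two φ a b))

theorem IsHom.neg (a : A.carrier) : φ (neg A a) = neg B (φ a) :=
  (h GiraleOp.neg ![a]).trans (congrArg (B.op GiraleOp.neg) (funext fun i : Fin 1 => by
    fin_cases i; rfl))

theorem IsHom.bang (a : A.carrier) : φ (bang A a) = bang B (φ a) :=
  (h GiraleOp.bang ![a]).trans (congrArg (B.op GiraleOp.bang) (funext fun i : Fin 1 => by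
    fin_cases i; rfl))

theorem IsHom.one : φ (one A) = one B :=
  (h GiraleOp.one ![]).trans (congrArg (B.op GiraleOp.one) (funext fun i : Fin 0 => i.elim0))

theorem IsHom.zero : φ (zero A) = zero B := by
  rw [Girales.zero, h.neg, h.one]; rfl

end hom

/-- The axioms of girales lift along a separating family of homomorphisms. -/
theorem IsGirale.of_mem_SP {G A : UAlg.{u} giraleType} (hG : IsGirale G) (hA : A ∈ SP G) :
    IsGirale A := by
  -- The order is defined by an equation, so it can be tested under all homomorphisms into `G`; this
  -- makes residuation, which is not an equation, a pointwise statement.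
  have le_iff : ∀ x y, le A x y ↔ ∀ h, IsHom A G h → le G (h x) (h y) := fun x y =>
    ⟨fun e h hh => by rw [le, ← hh.meet, e], fun e => hA _ _ fun h hh => by
      rw [hh.meet]; exact e h hh⟩
  constructor
  case residuation =>
    intro a b c
    rw [le_iff, le_iff]
    refine forall_congr' fun h => forall_congr' fun hh => ?_
    rw [hh.mul, hh.imp, hG.residuation]
  case bang_le =>
    intro a
    rw [le_iff]
    intro h hh
    rw [hh.bang, hh.meet, hh.one]
    exact hG.bang_le _
  all_goals intros; refine hA _ _ fun h hh => ?_
  all_goals simp only [hh.join, hh.meet, hh.mul, hh.imp, hh.neg, hh.bang, hh.one, hh.zero]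
  · exact hG.join_comm _ _
  · exact hG.join_assoc _ _ _
  · exact hG.meet_comm _ _
  · exact hG.meet_assoc _ _ _
  · exact hG.join_meet_self _ _
  · exact hG.meet_join_self _ _
  · exact hG.mul_comm _ _
  · exact hG.mul_assoc _ _ _
  · exact hG.one_mul _
  · exact hG.involutive _
  · exact hG.neg_eq _
  · exact hG.bang_one
  · exact hG.bang_mul_bang _ _
  · exact hG.bang_bang _

section hhom

variable {A B : UAlg.{u} heytType} {φ : A.carrier → B.carrier} (h : IsHom A B φ)
include h

theorem IsHom.hjoin (a b : A.carrier) : φ (hjoin A a b) = hjoin B (φ a) (φ b) :=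
  (h HeytOp.join ![a, b]).trans (congrArg (B.op HeytOp.join) (vec_two φ a b))

theorem IsHom.hmeet (a b : A.carrier) : φ (hmeet A a b) = hmeet B (φ a) (φ b) :=
  (h HeytOp.meet ![a, b]).trans (congrArg (B.op HeytOp.meet) (vec_two φ a b))

theorem IsHom.himp (a b : A.carrier) : φ (himp A a b) = himp B (φ a) (φ b) :=
  (h HeytOp.imp ![a, b]).trans (congrArg (B.op HeytOp.imp) (vec_two φ a b))

theorem IsHom.hbot : φ (hbot A) = hbot B :=
  (h HeytOp.bot ![]).trans (congrArg (B.op HeytOp.bot) (funext fun i : Fin 0 => i.elim0))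

theorem IsHom.hone : φ (hone A) = hone B :=
  (h HeytOp.one ![]).trans (congrArg (B.op HeytOp.one) (funext fun i : Fin 0 => i.elim0))

end hhom

/-- The axioms of Boolean algebras lift along a separating family of homomorphisms. -/
theorem IsBooleanAlg.of_separating {ι : Type*} {B : UAlg.{u} heytType} {C : ι → UAlg.{u} heytType}
    (φ : ∀ i, B.carrier → (C i).carrier) (hφ : ∀ i, IsHom B (C i) (φ i))
    (sep : ∀ x y, (∀ i, φ i x = φ i y) → x = y) (hC : ∀ i, IsBooleanAlg (C i)) :
    IsBooleanAlg B := by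
  have le_iff : ∀ x y, hle B x y ↔ ∀ i, hle (C i) (φ i x) (φ i y) := fun x y =>
    ⟨fun e i => by rw [hle, ← (hφ i).hmeet, e], fun e => sep _ _ fun i => by
      rw [(hφ i).hmeet]; exact e i⟩
  refine ⟨?_, fun a => sep _ _ fun i => ?_⟩
  · constructor
    case residuation =>
      intro a b c
      rw [le_iff, le_iff]
      refine forall_congr' fun i => ?_
      rw [(hφ i).hmeet, (hφ i).himp, (hC i).1.residuation]
    case bot_le =>
      intro a
      rw [le_iff]
      intro i
      rw [(hφ i).hbot]
      exact (hC i).1.bot_le _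
    case le_one =>
      intro a
      rw [le_iff]
      intro i
      rw [(hφ i).hone]
      exact (hC i).1.le_one _
    all_goals intros; refine sep _ _ fun i => ?_
    all_goals simp only [(hφ i).hjoin, (hφ i).hmeet]
    · exact (hC i).1.join_comm _ _
    · exact (hC i).1.join_assoc _ _ _
    · exact (hC i).1.meet_comm _ _
    · exact (hC i).1.meet_assoc _ _ _
    · exact (hC i).1.join_meet_self _ _
    · exact (hC i).1.meet_join_self _ _
  · rw [(hφ i).hjoin, (hφ i).himp, (hφ i).hbot, (hφ i).hone]
    exact (hC i).2 _

theorem IsBooleanAlg.of_iso {B C : UAlg.{u} heytType} (h : Iso B C) (hC : IsBooleanAlg C) :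
    IsBooleanAlg B := by
  obtain ⟨φ, h1, h2⟩ := h
  exact .of_separating (ι := Unit) (C := fun _ => C) (fun _ => φ) (fun _ => h1)
    (fun x y e => h2.1 (e ())) fun _ => hC

theorem IsBooleanAlg.of_surjective {A B : UAlg.{u} heytType} (hA : IsBooleanAlg A)
    {φ : A.carrier → B.carrier} (h : IsHom A B φ) (hs : Function.Surjective φ) :
    IsBooleanAlg B := by
  obtain ⟨hA, hc⟩ := hA
  have mono : ∀ x y, hle A x y → hle B (φ x) (φ y) := fun x y e => by
    rw [hle, ← h.hmeet, e]
  have left : ∀ x y, hle A (hmeet A x y) y := fun x y => by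
    have h1 : hmeet A y y = y := by
      have h1 := hA.meet_join_self y (hmeet A y y)
      rwa [hA.join_meet_self] at h1
    rw [hle, hA.meet_assoc, h1]
  refine ⟨?_, ?_⟩
  · constructor
    case residuation =>
      intro a b c
      obtain ⟨a, rfl⟩ := hs a
      obtain ⟨b, rfl⟩ := hs b
      obtain ⟨c, rfl⟩ := hs c
      constructor
      · intro e
        -- Residuation is not an equation, so preimages must be adjusted: `c` is replaced by `(a ∧
        -- b) ∨ c`, which has the same image and lies above `a ∧ b`.
        have h1 : φ (hjoin A (hmeet A a b) c) = φ c := by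
          have h3 : hmeet B (hmeet B (φ a) (φ b)) (φ c) = hmeet B (φ a) (φ b) := e
          rw [h.hjoin, h.hmeet, ← h3, ← h.hmeet, ← h.hmeet, ← h.hjoin, hA.join_comm, hA.meet_comm,
            hA.join_meet_self]
        have h2 := mono _ _ ((hA.residuation _ _ _).1 (hA.meet_join_self (hmeet A a b) c))
        rwa [h.himp, h1] at h2
      · intro e
        -- Dually, `a` is replaced by `a ∧ (b → c)`, which has the same image and lies below `b →
        -- c`.
        have h1 : φ (hmeet A a (himp A b c)) = φ a := by
          rw [h.hmeet, h.himp]; exact e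
        have h2 := mono _ _ ((hA.residuation _ _ _).2 (left a (himp A b c)))
        rwa [h.hmeet, h1] at h2
    case bot_le =>
      intro a
      obtain ⟨a, rfl⟩ := hs a
      rw [← h.hbot]
      exact mono _ _ (hA.bot_le a)
    case le_one =>
      intro a
      obtain ⟨a, rfl⟩ := hs a
      rw [← h.hone]
      exact mono _ _ (hA.le_one a)
    all_goals (rw [hs.forall₂]; intro a b)
    case join_comm => rw [← h.hjoin, hA.join_comm, h.hjoin]
    case meet_comm => rw [← h.hmeet, hA.meet_comm, h.hmeet]
    case join_meet_self => rw [← h.hmeet, ← h.hjoin, hA.join_meet_self]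
    case meet_join_self => rw [← h.hjoin, ← h.hmeet, hA.meet_join_self]
    all_goals intro c; obtain ⟨c, rfl⟩ := hs c
    case join_assoc => simp only [← h.hjoin, hA.join_assoc]
    case meet_assoc => simp only [← h.hmeet, hA.meet_assoc]
  · intro a
    obtain ⟨a, rfl⟩ := hs a
    rw [← h.hbot, ← h.himp, ← h.hjoin, hc, h.hone]

theorem isVariety_booleanAlgs : IsVariety BooleanAlgs.{u} where
  closed_H _ hA _ := fun ⟨_, h, hs⟩ => IsBooleanAlg.of_surjective hA h hs
  closed_S A hA _ := fun ⟨φ, h, hi⟩ => IsBooleanAlg.of_separating (ι := Unit) (C := fun _ => A)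
    (fun _ => φ) (fun _ => h) (fun _ _ e => hi (e ())) fun _ => hA
  closed_P _ A hA := IsBooleanAlg.of_separating (fun i x => x i) (fun i => isHom_proj A i)
    (fun _ _ e => funext e) hA

/-- Homomorphisms of girales restrict to the images of `!`. -/
theorem isHom_bangAlg {A B : UAlg.{u} giraleType} (hA : IsGirale A) (hB : IsGirale B)
    {φ : A.carrier → B.carrier} (h : IsHom A B φ) :
    IsHom (bangAlg A hA) (bangAlg B hB)
      (fun x => ⟨φ x.1, φ x.2.choose, by rw [← h.bang, x.2.choose_spec]⟩) := by
  intro f x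
  cases f
  · exact Subtype.ext (h.join _ _)
  · exact Subtype.ext ((h.bang _).trans (congrArg _ (h.meet _ _)))
  · exact Subtype.ext ((h.bang _).trans (congrArg _ (h.imp _ _)))
  · exact Subtype.ext ((h.bang _).trans (congrArg _ h.zero))
  · exact Subtype.ext h.one

theorem IsBooleanGirale.of_mem_SP {G A : UAlg.{u} giraleType} (hG : IsBooleanGirale G)
    (hA : A ∈ SP G) : IsBooleanGirale A := by
  obtain ⟨h1, h2⟩ := hG
  refine ⟨h1.of_mem_SP hA, .of_separating (ι := {φ // IsHom A G φ}) (C := fun _ => bangAlg G h1) _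
    (fun i => isHom_bangAlg (h1.of_mem_SP hA) h1 i.2) (fun x y e => Subtype.ext ?_) fun _ => h2⟩
  exact hA _ _ fun φ hφ => congrArg Subtype.val (e ⟨φ, hφ⟩)

end Girales

/-! ### Discriminator girales: simplicity, generated varieties, atoms. -/

namespace Girales

open Classical in
/-- The element `1` or `!0` of a girale, according to the truth of a proposition. -/
noncomputable def truthValue (A : UAlg.{u} giraleType) (P : Prop) : A.carrier :=
  if P then one A else bang A (zero A)

/-- Finite girales in which `!` takes two values only, and detects equality. -/
structure IsDiscriminatorGirale (G : UAlg.{u} giraleType) : Prop where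
  girale : IsGirale G
  finite : Finite G.carrier
  bang_zero_ne_one : bang G (zero G) ≠ one G
  bang_zero_mul : ∀ x, mul G (bang G (zero G)) x = bang G (zero G)
  bang_eq : ∀ x, ∃ P, bang G x = truthValue G P
  join_truthValue : ∀ P Q, join G (truthValue G P) (truthValue G Q) = truthValue G (P ∨ Q)
  meet_truthValue : ∀ P Q,
    bang G (meet G (truthValue G P) (truthValue G Q)) = truthValue G (P ∧ Q)
  imp_truthValue : ∀ P Q,
    bang G (imp G (truthValue G P) (truthValue G Q)) = truthValue G (P → Q)
  bang_equiv : ∀ x y, bang G (meet G (imp G x y) (imp G y x)) = truthValue G (x = y)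

theorem truthValue_true (A : UAlg.{u} giraleType) : truthValue A True = one A := if_pos trivial

theorem truthValue_false (A : UAlg.{u} giraleType) : truthValue A False = bang A (zero A) :=
  if_neg id

theorem IsHom.truthValue {A B : UAlg.{u} giraleType} {φ : A.carrier → B.carrier} (h : IsHom A B φ)
    (P : Prop) : φ (truthValue A P) = truthValue B P := by
  by_cases hP : P
  · simp only [hP, truthValue_true, h.one]
  · simp only [hP, truthValue_false, h.bang, h.zero]

namespace IsDiscriminatorGirale

variable {G : UAlg.{u} giraleType} (hG : IsDiscriminatorGirale G)
include hG

theorem truthValue_inj {P Q : Prop} : truthValue G P = truthValue G Q ↔ (P ↔ Q) := by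
  have := hG.bang_zero_ne_one
  by_cases hP : P <;> by_cases hQ : Q <;> simp [hP, hQ, truthValue_true, truthValue_false, this,
    this.symm]

theorem bang_truthValue (P : Prop) : bang G (truthValue G P) = truthValue G P := by
  by_cases hP : P
  · simp only [hP, truthValue_true, hG.girale.bang_one]
  · simp only [hP, truthValue_false, hG.girale.bang_bang]

/-- The elements of `!G` are truth values and its operations are the connectives, so each axiom
becomes a propositional tautology. -/
theorem isBooleanGirale : IsBooleanGirale G := by
  refine ⟨hG.girale, ?_⟩
  have key : ∀ u : (bangAlg G hG.girale).carrier, ∃ P, u.1 = truthValue G P := fun u => by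
    obtain ⟨x, hx⟩ := u.2
    obtain ⟨P, hP⟩ := hG.bang_eq x
    exact ⟨P, hx ▸ hP⟩
  have hj : ∀ u v : (bangAlg G hG.girale).carrier, (hjoin _ u v).1 = join G u.1 v.1 :=
    fun _ _ => rfl
  have hm : ∀ u v : (bangAlg G hG.girale).carrier, (hmeet _ u v).1 = bang G (meet G u.1 v.1) :=
    fun _ _ => rfl
  have hi : ∀ u v : (bangAlg G hG.girale).carrier, (himp _ u v).1 = bang G (imp G u.1 v.1) :=
    fun _ _ => rfl
  have hb : (hbot (bangAlg G hG.girale)).1 = truthValue G False := (truthValue_false G).symm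
  have ho : (hone (bangAlg G hG.girale)).1 = truthValue G True := (truthValue_true G).symm
  have hext : ∀ u v : (bangAlg G hG.girale).carrier, u = v ↔ u.1 = v.1 := fun _ _ => Subtype.ext_iff
  refine ⟨?_, fun a => ?_⟩
  · constructor
    case bot_le =>
      intro a
      obtain ⟨P, hP⟩ := key a
      simp only [hle, hext, hm, hb, hP, hG.meet_truthValue, hG.truthValue_inj]
      tauto
    case le_one =>
      intro a
      obtain ⟨P, hP⟩ := key a
      simp only [hle, hext, hm, ho, hP, hG.meet_truthValue, hG.truthValue_inj]
      tauto
    all_goals intro a b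
    all_goals obtain ⟨P, hP⟩ := key a
    all_goals obtain ⟨Q, hQ⟩ := key b
    case residuation =>
      intro c
      obtain ⟨R, hR⟩ := key c
      simp only [hle, hext, hm, hi, hP, hQ, hR, hG.meet_truthValue, hG.imp_truthValue,
        hG.truthValue_inj]
      tauto
    case join_assoc | meet_assoc =>
      intro c
      obtain ⟨R, hR⟩ := key c
      simp only [hext, hj, hm, hP, hQ, hR, hG.meet_truthValue, hG.join_truthValue,
        hG.truthValue_inj]
      tauto
    all_goals
      simp only [hext, hj, hm, hP, hQ, hG.meet_truthValue, hG.join_truthValue, hG.truthValue_inj]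
      tauto
  · obtain ⟨P, hP⟩ := key a
    simp only [hext, hj, hi, hb, ho, hP, hG.imp_truthValue, hG.join_truthValue, hG.truthValue_inj]
    tauto

/-- Algebras that embed into a discriminator girale are simple. -/
theorem isSimpleAlg_of_embedding {A : UAlg.{u} giraleType} {h : A.carrier → G.carrier}
    (hh : IsHom A G h) (inj : Function.Injective h) : IsSimpleAlg A := by
  refine ⟨⟨bang A (zero A), one A, fun e => hG.bang_zero_ne_one ?_⟩, fun θ hθ => ?_⟩
  · rw [← hh.one, ← e, hh.bang, hh.zero]
  · rw [or_iff_not_imp_left]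
    intro hne
    obtain ⟨x, y, hxy, hne⟩ : ∃ x y, θ x y ∧ x ≠ y := by
      by_contra! hc
      exact hne (le_bot_iff.1 fun x y hxy => hc x y hxy)
    have pair : ∀ {a b c d : A.carrier}, θ a b → θ c d →
        ∀ i : Fin 2, θ (![a, c] i) (![b, d] i) := fun h1 h2 i => by
      fin_cases i
      · exact h1
      · exact h2
    -- Modulo `θ` the equality test of `x, y`, which is `!0`, agrees with that of `x, x`, which is
    -- `1`.
    have h1 : θ (imp A x y) (imp A x x) :=
      hθ GiraleOp.imp _ _ (pair (θ.refl x) (θ.symm hxy))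
    have h2 : θ (imp A y x) (imp A x x) :=
      hθ GiraleOp.imp _ _ (pair (θ.symm hxy) (θ.refl x))
    have h3 : θ (meet A (imp A x y) (imp A y x)) (meet A (imp A x x) (imp A x x)) :=
      hθ GiraleOp.meet _ _ (pair h1 h2)
    have h4 : θ (bang A (meet A (imp A x y) (imp A y x)))
        (bang A (meet A (imp A x x) (imp A x x))) :=
      hθ GiraleOp.bang ![_] ![_] fun i : Fin 1 => by fin_cases i; exact h3
    have hd : ∀ a b, bang A (meet A (imp A a b) (imp A b a)) = truthValue A (a = b) :=
      fun a b => inj (by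
        rw [hh.bang, hh.meet, hh.imp, hh.imp, hG.bang_equiv, hh.truthValue, inj.eq_iff])
    rw [hd, hd, eq_false hne, eq_self, truthValue_true, truthValue_false] at h4
    -- Multiplying `!0 ≡ 1` by `z` gives `!0 ≡ z`, since `!0` is absorbing.
    have hz : ∀ z, θ (bang A (zero A)) z := fun z => by
      have h5 : θ (mul A (bang A (zero A)) z) (mul A (one A) z) :=
        hθ GiraleOp.mul _ _ (pair h4 (θ.refl z))
      have h6 : mul A (bang A (zero A)) z = bang A (zero A) := inj (by
        rw [hh.mul, hh.bang, hh.zero, hG.bang_zero_mul])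
      have h7 : mul A (one A) z = z := inj (by
        rw [hh.mul, hh.one, hG.girale.one_mul])
      rwa [h6, h7] at h5
    exact top_le_iff.1 fun a b _ => θ.trans (θ.symm (hz a)) (hz b)

theorem isSimpleAlg : IsSimpleAlg G :=
  hG.isSimpleAlg_of_embedding (h := id) (fun _ _ => rfl) Function.injective_id

/-- If `φ x ≠ φ y`, a homomorphism `A → G` is needed that separates `x` from `y` and is constant on
the fibres of `φ`. It is the limit of homomorphisms `A → G` along an ultrafilter that contains the
equalizers of all pairs in the kernel of `φ` and the set where `x` and `y` have different values. -/
theorem SP_closed_H {A B : UAlg.{u} giraleType} (hA : A ∈ SP G) {φ : A.carrier → B.carrier}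
    (hφ : IsHom A B φ) (hs : Function.Surjective φ) : B ∈ SP G := by
  have := hG.finite
  intro x y hxy
  by_contra hne
  obtain ⟨x, rfl⟩ := hs x
  obtain ⟨y, rfl⟩ := hs y
  let I := {h : A.carrier → G.carrier // IsHom A G h}
  have gA := hG.girale.of_mem_SP hA
  let d : A.carrier → A.carrier → A.carrier := fun a b => bang A (meet A (imp A a b) (imp A b a))
  have hd : ∀ (h : A.carrier → G.carrier), IsHom A G h →
      ∀ a b, h (d a b) = truthValue G (h a = h b) := fun h hh a b => by
    rw [hh.bang, hh.meet, hh.imp, hh.imp, hG.bang_equiv]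
  have dself : ∀ a, d a a = one A := fun a => hA _ _ fun h hh => by
    rw [hd h hh, eq_self, truthValue_true, hh.one]
  have φd : ∀ a b, φ a = φ b → φ (d a b) = one B := fun a b e => by
    rw [← hφ.one, ← dself a, hφ.bang, hφ.meet, hφ.imp, hφ.imp, hφ.bang, hφ.meet, hφ.imp, e]
  -- the filter of the equalizers of pairs in the kernel of `φ`
  let F : Filter I :=
    { sets := {S | ∃ a b, φ a = φ b ∧ ∀ i : I, i.1 a = i.1 b → i ∈ S}
      univ_sets := ⟨x, x, rfl, fun _ _ => trivial⟩
      sets_of_superset := fun ⟨a, b, h1, h2⟩ hST => ⟨a, b, h1, fun i hi => hST (h2 i hi)⟩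
      inter_sets := by
        rintro S T ⟨a, b, h1, h2⟩ ⟨a', b', h1', h2'⟩
        -- Two equalizers intersect in a single one: in `G` each factor is `1` or the absorbing
        -- `!0`, so the product is `1` only if both pairs are equalized.
        refine ⟨mul A (d a b) (d a' b'), one A, ?_, fun i hi => ?_⟩
        · rw [hφ.mul, φd _ _ h1, φd _ _ h1', hφ.one, ← hφ.one, ← hφ.mul, gA.one_mul]
        · rw [i.2.mul, hd _ i.2, hd _ i.2, i.2.one] at hi
          by_cases h3 : i.1 a = i.1 b
          · by_cases h4 : i.1 a' = i.1 b'
            · exact ⟨h2 i h3, h2' i h4⟩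
            · rw [hG.girale.mul_comm, eq_false h4, truthValue_false, hG.bang_zero_mul] at hi
              exact absurd hi hG.bang_zero_ne_one
          · rw [eq_false h3, truthValue_false, hG.bang_zero_mul] at hi
            exact absurd hi hG.bang_zero_ne_one }
  have hF : ∀ a b, φ a = φ b → ∀ᶠ i in F, i.1 a = i.1 b := fun a b e => ⟨a, b, e, fun _ h => h⟩
  have hfreq : ∃ᶠ i in F, i.1 x ≠ i.1 y := by
    rintro ⟨a, b, e, hab⟩
    -- If `x` and `y` agree wherever `a` and `b` do, multiplying by the equality test of `a, b`
    -- makes them equal in `A`; `φ` sends that test to `1`, so `φ x = φ y`.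
    have h1 : mul A (d a b) x = mul A (d a b) y := hA _ _ fun h hh => by
      rw [hh.mul, hh.mul, hd h hh]
      by_cases h2 : h a = h b
      · have h3 : h x = h y := not_not.1 (hab ⟨h, hh⟩ h2)
        rw [h3]
      · rw [eq_false h2, truthValue_false, hG.bang_zero_mul, hG.bang_zero_mul]
    have h2 := congrArg φ h1
    rw [hφ.mul, hφ.mul, φd _ _ e, ← hφ.one, ← hφ.mul, ← hφ.mul, gA.one_mul, gA.one_mul] at h2
    exact hne h2
  have hNe : (F ⊓ Filter.principal {i : I | i.1 x ≠ i.1 y}).NeBot :=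
    Filter.frequently_mem_iff_neBot.1 hfreq
  let U := Ultrafilter.of (F ⊓ Filter.principal {i : I | i.1 x ≠ i.1 y})
  have hU : ↑U ≤ F ⊓ Filter.principal {i : I | i.1 x ≠ i.1 y} := Ultrafilter.of_le _
  -- As `G` is finite, the values at `a` are constant on a set of the ultrafilter.
  have lim : ∀ a : A.carrier, ∃ g, ∀ᶠ i : I in U, i.1 a = g := fun a => by
    rw [← Ultrafilter.eventually_exists_iff]
    exact Filter.Eventually.of_forall fun i => ⟨_, rfl⟩
  choose L hL using lim
  have hLhom : IsHom A G L := fun f z => by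
    -- Arities are finite, so one homomorphism `i` agrees with `L` on all arguments and on the
    -- result.
    have h1 : ∀ᶠ i : I in U, ∀ j, i.1 (z j) = L (z j) := Filter.eventually_all.2 fun j => hL (z j)
    obtain ⟨i, hi1, hi2⟩ := (h1.and (hL (A.op f z))).exists
    rw [← hi2, i.2]
    congr 1
    funext j
    exact hi1 j
  have hLker : ∀ a b, φ a = φ b → L a = L b := fun a b e => by
    have h0 : ∀ᶠ i : I in U, i.1 a = i.1 b := hU.trans inf_le_left (hF a b e)
    obtain ⟨i, hi, h1, h2⟩ := (h0.and ((hL a).and (hL b))).exists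
    rw [← h1, ← h2]
    exact hi
  have hLne : L x ≠ L y := by
    have h0 : ∀ᶠ i : I in U, i.1 x ≠ i.1 y := hU.trans inf_le_right (Filter.mem_principal_self _)
    obtain ⟨i, hi, h1, h2⟩ := (h0.and ((hL x).and (hL y))).exists
    rw [← h1, ← h2]
    exact hi
  refine hLne ?_
  -- Being constant on the fibres of `φ`, `L` descends to a homomorphism `B → G` through any section
  -- of `φ`.
  have hinv := Function.rightInverse_surjInv hs
  have h1 : ∀ a, L (Function.surjInv hs (φ a)) = L a := fun a => hLker _ _ (hinv _)
  have h2 := hxy (fun b => L (Function.surjInv hs b)) fun f z => by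
    have h3 : B.op f z = φ (A.op f fun j => Function.surjInv hs (z j)) := by
      rw [hφ]
      congr 1
      funext j
      exact (hinv _).symm
    show L (Function.surjInv hs (B.op f z)) = _
    rw [h3, h1, hLhom]
  simpa only [h1] using h2

theorem V_eq_SP : V G = SP G :=
  (V_subset ⟨fun _ hA _ ⟨_, h, hs⟩ => hG.SP_closed_H hA h hs,
    fun _ hA _ ⟨_, h, hi⟩ => SP_closed_S hA h hi, fun _ _ hA => SP_closed_P hA⟩
    (mem_SP_self G)).antisymm (SP_subset_V G)

theorem isGiraleVariety_V : IsGiraleVariety (V G) :=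
  ⟨isVariety_V G, fun _ hA => hG.girale.of_mem_SP (hG.V_eq_SP ▸ hA)⟩

theorem isBooleanGirale_of_mem_V {A : UAlg.{u} giraleType} (hA : A ∈ V G) : IsBooleanGirale A :=
  hG.isBooleanGirale.of_mem_SP (hG.V_eq_SP ▸ hA)

/-- If every homomorphism into a discriminator girale is surjective, then the latter generates an
atom of the lattice of varieties. -/
theorem isAtomVariety_V
    (hsurj : ∀ (A : UAlg.{u} giraleType) (h : A.carrier → G.carrier), IsHom A G h →
      Function.Surjective h) : IsAtomVariety (V G) := by
  refine ⟨isVariety_V G, fun e => ?_, fun W hW hWG => ?_⟩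
  · have h1 : Subsingleton G.carrier := by
      have : G ∈ trivialClass giraleType := e ▸ mem_V_self G
      exact this
    exact hG.bang_zero_ne_one (Subsingleton.elim _ _)
  · rw [or_iff_not_imp_left]
    intro hne
    by_cases hsub : W ⊆ trivialClass giraleType
    · refine absurd (hsub.antisymm fun A hA => ?_) hne
      have hA : Subsingleton A.carrier := hA
      -- The empty product lies in every variety and maps onto every one-element algebra; `one A`
      -- shows that `A` is nonempty.
      exact hW.closed_H _ (hW.closed_P PEmpty PEmpty.elim fun i => i.elim) A
        ⟨fun _ => one A, fun _ _ => Subsingleton.elim _ _,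
          fun a => ⟨fun i => i.elim, Subsingleton.elim _ _⟩⟩
    · obtain ⟨A, hAW, hA⟩ := Set.not_subset.1 hsub
      obtain ⟨x, y, hxy⟩ := not_subsingleton_iff_nontrivial.1 hA
      obtain ⟨h, hh, _⟩ := exists_hom_of_mem_SP (hG.V_eq_SP ▸ hWG hAW) hxy
      exact hWG.antisymm (V_subset hW (hW.closed_H A hAW G ⟨h, hh, hsurj A h hh⟩))

end IsDiscriminatorGirale

end Girales

/-! ### The algebras `G n`: axioms, subalgebras, subdirectly irreducibles. -/

namespace Girales

theorem isGirale_twoAlg : IsGirale twoAlg.{u} := by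
  constructor
  case residuation =>
    rintro ⟨a⟩ ⟨b⟩ ⟨c⟩
    show (⟨_⟩ : ULift.{u} Bool) = ⟨_⟩ ↔ (⟨_⟩ : ULift.{u} Bool) = ⟨_⟩
    rw [ULift.up_inj, ULift.up_inj]
    cases a <;> cases b <;> cases c <;> decide
  case bang_one => rfl
  case involutive | neg_eq | bang_le | one_mul | bang_bang => rintro ⟨a⟩; cases a <;> rfl
  case join_assoc | meet_assoc | mul_assoc =>
    rintro ⟨a⟩ ⟨b⟩ ⟨c⟩; cases a <;> cases b <;> cases c <;> rfl
  all_goals rintro ⟨a⟩ ⟨b⟩; cases a <;> cases b <;> rfl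

theorem isDiscriminatorGirale_twoAlg : IsDiscriminatorGirale twoAlg.{u} where
  girale := isGirale_twoAlg
  finite := inferInstanceAs (Finite (ULift.{u} Bool))
  bang_zero_ne_one h := by
    have h : (⟨false⟩ : ULift.{u} Bool) = ⟨true⟩ := h
    simp at h
  bang_zero_mul := by rintro ⟨a⟩; rfl
  bang_eq := by
    rintro ⟨a⟩
    cases a
    · exact ⟨False, (truthValue_false twoAlg).symm⟩
    · exact ⟨True, (truthValue_true twoAlg).symm⟩
  join_truthValue P Q := by
    by_cases hP : P <;> by_cases hQ : Q <;> simp only [hP, hQ, or_true, or_false,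
      truthValue_true, truthValue_false] <;> rfl
  meet_truthValue P Q := by
    by_cases hP : P <;> by_cases hQ : Q <;> simp only [hP, hQ, and_true, and_false,
      truthValue_true, truthValue_false] <;> rfl
  imp_truthValue P Q := by
    by_cases hP : P <;> by_cases hQ : Q <;> simp only [hP, hQ, imp_self, false_imp_iff,
      true_imp_iff, truthValue_true, truthValue_false] <;> rfl
  bang_equiv := by
    rintro ⟨a⟩ ⟨b⟩
    have h : truthValue twoAlg.{u} ((⟨a⟩ : ULift.{u} Bool) = ⟨b⟩) = truthValue twoAlg (a = b) :=
      congrArg _ (propext (ULift.up_inj ..))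
    refine Eq.trans ?_ h.symm
    cases a <;> cases b <;> simp only [reduceCtorEq, truthValue_true, truthValue_false] <;> rfl

namespace GElt

variable {k l : ℕ}

protected theorem join_comm (a b : GElt.{u} k) : join a b = join b a := by grind [join]

protected theorem join_assoc (a b c : GElt.{u} k) : join (join a b) c = join a (join b c) := by
  simp only [join]; grind

protected theorem meet_comm (a b : GElt.{u} k) : meet a b = meet b a := by grind [meet]

protected theorem meet_assoc (a b c : GElt.{u} k) : meet (meet a b) c = meet a (meet b c) := by
  simp only [meet]; grind

protected theorem join_meet_self (a b : GElt.{u} k) : join a (meet a b) = a := by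
  grind [join, meet]

protected theorem meet_join_self (a b : GElt.{u} k) : meet a (join a b) = a := by
  grind [join, meet]

protected theorem mul_comm (a b : GElt.{u} k) : mul a b = mul b a := by
  rcases a with _ | _ | _ | _ | i <;> rcases b with _ | _ | _ | _ | j <;> simp [mul, eq_comm]

protected theorem mul_assoc (a b c : GElt.{u} k) : mul (mul a b) c = mul a (mul b c) := by
  rcases a with _ | _ | _ | _ | i <;> rcases b with _ | _ | _ | _ | j <;>
    rcases c with _ | _ | _ | _ | l <;> simp only [mul] <;> split_ifs <;> rfl

protected theorem neg_neg (a : GElt.{u} k) : neg (neg a) = a := by cases a <;> rfl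

/-- The only case of residuation that needs a check of elements. -/
theorem mul_le_zero_iff (a b : GElt.{u} k) :
    meet (mul a b) zero = mul a b ↔ meet a (neg b) = a := by
  rcases a with _ | _ | _ | _ | i <;> rcases b with _ | _ | _ | _ | j <;>
    simp [mul, neg, meet]
  split_ifs <;> simp_all

/-- Both sides say that `a · b · ¬c ≤ 0`, by associativity and the involution. -/
protected theorem residuation (a b c : GElt.{u} k) :
    meet (mul a b) c = mul a b ↔ meet a (imp b c) = a := by
  have h : ∀ x y : GElt.{u} k, meet x y = x ↔ meet (mul x (neg y)) zero = mul x (neg y) :=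
    fun x y => by rw [mul_le_zero_iff, GElt.neg_neg]
  rw [h, imp, ← mul_le_zero_iff, GElt.mul_assoc]

theorem imp_zero (a : GElt.{u} k) : imp a zero = neg a := by cases a <;> rfl

theorem imp_imp_zero (a : GElt.{u} k) : imp (imp a zero) zero = a := by
  rw [imp_zero, imp_zero, GElt.neg_neg]

/-- Conceptually, `!z = 1` exactly when `1 ≤ z`, and `1 ≤ a → b` means `a ≤ b`; so this is
antisymmetry. -/
theorem bang_imp_meet_imp (a b : GElt.{u} k) :
    bang (meet (imp a b) (imp b a)) = if a = b then one else bot := by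
  rcases a with _ | _ | _ | _ | i <;> rcases b with _ | _ | _ | _ | j <;>
    simp [imp, mul, neg, meet, bang]
  split_ifs <;> simp_all

/-- The carrier of the finite algebra `G (k + 2)`. -/
def equivSum (k : ℕ) : GElt.{u} k ≃ Fin 4 ⊕ Fin k where
  toFun
    | bot => .inl 0
    | top => .inl 1
    | one => .inl 2
    | zero => .inl 3
    | mid i => .inr i
  invFun
    | .inl 0 => bot
    | .inl 1 => top
    | .inl 2 => one
    | .inl 3 => zero
    | .inr i => mid i
  left_inv x := by cases x <;> rfl
  right_inv x := by
    rcases x with i | i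
    · fin_cases i <;> rfl
    · rfl

/-- The map induced by a map between the indices of the further atoms. -/
def map (f : Fin k → Fin l) : GElt.{u} k → GElt.{u} l
  | bot => bot
  | top => top
  | one => one
  | zero => zero
  | mid i => mid (f i)

theorem map_injective {f : Fin k → Fin l} (hf : Function.Injective f) :
    Function.Injective (map.{u} f) := by
  intro a b h
  cases a <;> cases b <;> simp_all [map, hf.eq_iff]

end GElt

open GElt in
theorem isGirale_G_add_two (k : ℕ) : IsGirale (G.{u} (k + 2)) where
  join_comm := GElt.join_comm (k := k)
  join_assoc := GElt.join_assoc (k := k)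
  meet_comm := GElt.meet_comm (k := k)
  meet_assoc := GElt.meet_assoc (k := k)
  join_meet_self := GElt.join_meet_self (k := k)
  meet_join_self := GElt.meet_join_self (k := k)
  mul_comm := GElt.mul_comm (k := k)
  mul_assoc := GElt.mul_assoc (k := k)
  one_mul a := by rcases a with _ | _ | _ | _ | i <;> rfl
  residuation := GElt.residuation (k := k)
  involutive := GElt.imp_imp_zero (k := k)
  neg_eq a := (GElt.imp_zero (k := k) a).symm
  bang_one := rfl
  bang_le a := by
    show GElt.meet (GElt.bang a) (GElt.meet a GElt.one) = GElt.bang a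
    rcases a with _ | _ | _ | _ | i <;> simp [GElt.meet, GElt.bang]
  bang_mul_bang a b := by
    show GElt.mul (GElt.bang a) (GElt.bang b) = GElt.bang (GElt.meet a b)
    rcases a with _ | _ | _ | _ | i <;> rcases b with _ | _ | _ | _ | j <;>
      simp [GElt.meet, GElt.bang, GElt.mul]
    split_ifs <;> rfl
  bang_bang a := by rcases a with _ | _ | _ | _ | i <;> rfl

theorem truthValue_G_add_two (k : ℕ) (P : Prop) [Decidable P] :
    truthValue (G.{u} (k + 2)) P = if P then GElt.one else (GElt.bot : GElt.{u} k) := by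
  by_cases hP : P
  · simp only [hP, truthValue_true]; rfl
  · simp only [hP, truthValue_false]; rfl

theorem isDiscriminatorGirale_G_add_two (k : ℕ) : IsDiscriminatorGirale (G.{u} (k + 2)) where
  girale := isGirale_G_add_two k
  finite := Finite.of_equiv _ (GElt.equivSum.{u} k).symm
  bang_zero_ne_one h := by
    have h : (GElt.bot : GElt.{u} k) = GElt.one := h
    simp at h
  bang_zero_mul a := by rcases a with _ | _ | _ | _ | i <;> rfl
  bang_eq a := by
    refine ⟨GElt.bang (k := k) a = GElt.one, ?_⟩
    rw [truthValue_G_add_two]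
    rcases a with _ | _ | _ | _ | i <;> rfl
  join_truthValue P Q := by
    by_cases hP : P <;> by_cases hQ : Q <;> simp only [hP, hQ, or_true, or_false,
      truthValue_true, truthValue_false] <;> rfl
  meet_truthValue P Q := by
    by_cases hP : P <;> by_cases hQ : Q <;> simp only [hP, hQ, and_true, and_false,
      truthValue_true, truthValue_false] <;> rfl
  imp_truthValue P Q := by
    by_cases hP : P <;> by_cases hQ : Q <;> simp only [hP, hQ, imp_self, false_imp_iff,
      true_imp_iff, truthValue_true, truthValue_false] <;> rfl
  bang_equiv a b := by
    classical
    rw [truthValue_G_add_two]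
    exact (GElt.bang_imp_meet_imp (k := k) a b).trans (by congr)

theorem isDiscriminatorGirale_G {n : ℕ} (hn : 1 ≤ n) : IsDiscriminatorGirale (G.{u} n) := by
  rcases n with _ | _ | k
  · omega
  · exact isDiscriminatorGirale_twoAlg
  · exact isDiscriminatorGirale_G_add_two k

theorem card_G_one : Nat.card (G.{u} 1).carrier = 2 := by
  show Nat.card (ULift.{u} Bool) = 2
  simp

theorem card_G {n : ℕ} (hn : 2 ≤ n) : Nat.card (G.{u} n).carrier = n + 2 := by
  obtain ⟨k, rfl⟩ := Nat.exists_eq_add_of_le' hn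
  show Nat.card (GElt.{u} k) = _
  rw [Nat.card_congr (GElt.equivSum k)]
  simp
  omega

/-- Joins, meets and products of further atoms depend on whether the arguments are equal, so `f` has
to be injective. -/
theorem isHom_GElt_map {k l : ℕ} {f : Fin k → Fin l} (hf : Function.Injective f) :
    IsHom (G.{u} (k + 2)) (G.{u} (l + 2)) (GElt.map f) := by
  have inj := GElt.map_injective.{u} hf
  have hneg : ∀ a : GElt.{u} k, GElt.map f a.neg = (GElt.map f a).neg := fun a => by
    cases a <;> rfl
  have hmul : ∀ a b : GElt.{u} k, GElt.map f (a.mul b) = (GElt.map f a).mul (GElt.map f b) := by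
    intro a b
    rcases a with _ | _ | _ | _ | i <;> rcases b with _ | _ | _ | _ | j <;>
      simp [GElt.map, GElt.mul, hf.eq_iff]
    split_ifs <;> rfl
  have hbang : ∀ a : GElt.{u} k, GElt.map f a.bang = (GElt.map f a).bang := fun a => by
    cases a <;> rfl
  have hbot : ∀ a : GElt.{u} k, GElt.map f a = .bot ↔ a = .bot := fun a => by
    cases a <;> simp [GElt.map]
  have htop : ∀ a : GElt.{u} k, GElt.map f a = .top ↔ a = .top := fun a => by
    cases a <;> simp [GElt.map]
  intro g (x : Fin (giraleType.arity g) → GElt.{u} k)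
  cases g
  · show GElt.map f (GElt.join _ _) = GElt.join (GElt.map f _) (GElt.map f _)
    simp only [GElt.join, inj.eq_iff, hbot]
    split_ifs <;> rfl
  · show GElt.map f (GElt.meet _ _) = GElt.meet (GElt.map f _) (GElt.map f _)
    simp only [GElt.meet, inj.eq_iff, htop]
    split_ifs <;> rfl
  · show GElt.map f (GElt.imp _ _) = GElt.imp (GElt.map f _) (GElt.map f _)
    simp only [GElt.imp, hneg, hmul]
  · exact hmul _ _
  · exact hneg _
  · rfl
  · show GElt.map f (GElt.bang _) = GElt.bang (GElt.map f _)
    exact hbang _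

/-- An algebra that embeds into `G (k + 2)` is isomorphic to one of its subalgebras `G m`. -/
theorem exists_iso_G_of_embedding {k : ℕ} {A : UAlg.{u} giraleType}
    {h : A.carrier → (G.{u} (k + 2)).carrier} (hh : IsHom A (G.{u} (k + 2)) h)
    (inj : Function.Injective h) : ∃ m, 2 ≤ m ∧ m ≤ k + 2 ∧ Iso A (G.{u} m) := by
  classical
  -- The further atoms in the range of `h`; the other four elements are values of constant terms and
  -- always lie in it.
  let M := {i : Fin k // ∃ a, h a = (GElt.mid i : GElt.{u} k)}
  let e : Fin (Fintype.card M) ≃ M := (Fintype.equivFin M).symm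
  have hf : Function.Injective fun i => (e i).1 := Subtype.val_injective.comp e.injective
  refine ⟨Fintype.card M + 2, by omega, ?_, iso_of_range_eq hh inj (isHom_GElt_map hf)
    (GElt.map_injective hf) ?_⟩
  · have : Fintype.card M ≤ Fintype.card (Fin k) := Fintype.card_subtype_le _
    rw [Fintype.card_fin] at this
    omega
  · refine Set.Subset.antisymm ?_ ?_
    · rintro _ ⟨a, rfl⟩
      generalize hx : h a = x
      rcases x with _ | _ | _ | _ | i
      · exact ⟨GElt.bot, rfl⟩
      · exact ⟨GElt.top, rfl⟩
      · exact ⟨GElt.one, rfl⟩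
      · exact ⟨GElt.zero, rfl⟩
      · refine ⟨GElt.mid (e.symm ⟨i, a, hx⟩), ?_⟩
        show GElt.mid (e (e.symm _)).1 = _
        rw [e.apply_symm_apply]
    · rintro _ ⟨x, rfl⟩
      rcases x with _ | _ | _ | _ | i
      · exact ⟨bang A (zero A), by rw [hh.bang, hh.zero]; rfl⟩
      · exact ⟨neg A (bang A (zero A)), by rw [hh.neg, hh.bang, hh.zero]; rfl⟩
      · exact ⟨one A, by rw [hh.one]; rfl⟩
      · exact ⟨zero A, by rw [hh.zero]; rfl⟩
      · exact (e i).2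

theorem G_mem_V {m n : ℕ} (hm : 2 ≤ m) (hmn : m ≤ n) : G.{u} m ∈ V (G.{u} n) := by
  obtain ⟨k, rfl⟩ := Nat.exists_eq_add_of_le' hm
  obtain ⟨l, rfl⟩ := Nat.exists_eq_add_of_le' (hm.trans hmn)
  have h := Fin.castLE_injective (by omega : k ≤ l)
  exact (isVariety_V _).closed_S _ (mem_V_self _) _
    ⟨_, isHom_GElt_map h, GElt.map_injective h⟩

/-- The subdirectly irreducible algebras in `V (G n)`. -/
theorem mem_V_G_and_isSubdirectlyIrreducible_iff {n : ℕ} (hn : 2 ≤ n) (A : UAlg.{u} giraleType) :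
    (A ∈ V (G.{u} n) ∧ IsSubdirectlyIrreducible A) ↔
      ∃ m : ℕ, 2 ≤ m ∧ m ≤ n ∧ Iso A (G.{u} m) := by
  constructor
  · rintro ⟨h1, h2⟩
    rw [(isDiscriminatorGirale_G (by omega)).V_eq_SP] at h1
    obtain ⟨h, hh, inj⟩ := h2.exists_embedding h1
    obtain ⟨k, rfl⟩ := Nat.exists_eq_add_of_le' hn
    exact exists_iso_G_of_embedding hh inj
  · rintro ⟨m, hm, hmn, hiso⟩
    refine ⟨(isVariety_V _).mem_of_iso (G_mem_V hm hmn) hiso, ?_⟩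
    obtain ⟨φ, hφ, inj, _⟩ := hiso
    exact ((isDiscriminatorGirale_G (by omega)).isSimpleAlg_of_embedding hφ
      inj).isSubdirectlyIrreducible

theorem surjective_of_isHom_G_one {A : UAlg.{u} giraleType} {h : A.carrier → (G.{u} 1).carrier}
    (hh : IsHom A (G.{u} 1) h) : Function.Surjective h := by
  rintro ⟨_ | _⟩
  · exact ⟨zero A, hh.zero⟩
  · exact ⟨one A, hh.one⟩

/-- `G 2` has no further atoms: its elements are the constants `!0`, `¬!0`, `1` and `0`. -/
theorem surjective_of_isHom_G_two {A : UAlg.{u} giraleType} {h : A.carrier → (G.{u} 2).carrier}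
    (hh : IsHom A (G.{u} 2) h) : Function.Surjective h := by
  rintro (_ | _ | _ | _ | i)
  · exact ⟨bang A (zero A), by rw [hh.bang, hh.zero]; rfl⟩
  · exact ⟨neg A (bang A (zero A)), by rw [hh.neg, hh.bang, hh.zero]; rfl⟩
  · exact ⟨one A, hh.one⟩
  · exact ⟨zero A, hh.zero⟩
  · exact i.elim0

theorem mem_V_G_one_and_isSubdirectlyIrreducible_iff (A : UAlg.{u} giraleType) :
    (A ∈ V (G.{u} 1) ∧ IsSubdirectlyIrreducible A) ↔ Iso A (G.{u} 1) := by
  have h1 := isDiscriminatorGirale_G.{u} le_rfl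
  constructor
  · rintro ⟨hA, hs⟩
    rw [h1.V_eq_SP] at hA
    obtain ⟨h, hh, inj⟩ := hs.exists_embedding hA
    exact ⟨h, hh, inj, surjective_of_isHom_G_one hh⟩
  · intro hiso
    refine ⟨(isVariety_V _).mem_of_iso (mem_V_self _) hiso, ?_⟩
    obtain ⟨φ, hφ, inj, _⟩ := hiso
    exact (h1.isSimpleAlg_of_embedding hφ inj).isSubdirectlyIrreducible

theorem Iso.card_eq {σ : AlgType} {A B : UAlg.{u} σ} (h : Iso A B) :
    Nat.card A.carrier = Nat.card B.carrier := by
  obtain ⟨φ, _, h⟩ := h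
  exact Nat.card_eq_of_bijective φ h

theorem eq_of_iso_G {m n : ℕ} (hm : 1 ≤ m) (hn : 1 ≤ n) (h : Iso (G.{u} m) (G.{u} n)) : m = n := by
  have hc := h.card_eq
  rcases hm.eq_or_lt with rfl | hm <;> rcases hn.eq_or_lt with rfl | hn
  · rfl
  · rw [card_G_one, card_G hn] at hc; omega
  · rw [card_G_one, card_G hm] at hc; omega
  · rw [card_G hn, card_G hm] at hc; omega

/-- For `m < n` the simple algebra `G n` is too large to be among the subdirectly irreducibles of `V
(G m)`. -/
theorem eq_of_V_G_eq {m n : ℕ} (hm : 1 ≤ m) (hn : 1 ≤ n) (h : V (G.{u} m) = V (G.{u} n)) :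
    m = n := by
  wlog hmn : m < n generalizing m n
  · rcases (not_lt.1 hmn).eq_or_lt with h1 | h1
    · exact h1.symm
    · exact (this hn hm h.symm h1).symm
  have hs : G.{u} n ∈ V (G.{u} m) ∧ IsSubdirectlyIrreducible (G.{u} n) :=
    ⟨h ▸ mem_V_self _, (isDiscriminatorGirale_G hn).isSimpleAlg.isSubdirectlyIrreducible⟩
  rcases hm.eq_or_lt with rfl | hm
  · rw [mem_V_G_one_and_isSubdirectlyIrreducible_iff] at hs
    exact (eq_of_iso_G hn le_rfl hs).symm
  · rw [mem_V_G_and_isSubdirectlyIrreducible_iff hm] at hs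
    obtain ⟨l, h1, h2, h3⟩ := hs
    have := eq_of_iso_G hn (by omega) h3
    omega

/-- A common member satisfies `¬!0 = 1`, since `G 1` does. In `G 2` this would read `⊤ = 1`, so
there is no homomorphism into `G 2`, and points are separated only vacuously. -/
theorem V_G_one_inter_V_G_two : V (G.{u} 1) ∩ V (G.{u} 2) = trivialClass giraleType := by
  have h1 := isDiscriminatorGirale_G.{u} le_rfl
  have h2 := isDiscriminatorGirale_G.{u} one_le_two
  ext A
  constructor
  · rintro ⟨hA1, hA2⟩
    rw [h1.V_eq_SP] at hA1
    rw [h2.V_eq_SP] at hA2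
    have key : neg A (bang A (zero A)) = one A := hA1 _ _ fun h hh => by
      rw [hh.neg, hh.bang, hh.zero, hh.one]; rfl
    refine ⟨fun x y => hA2 _ _ fun h hh => ?_⟩
    have h3 := congrArg h key
    rw [hh.neg, hh.bang, hh.zero, hh.one] at h3
    exact GElt.noConfusion rfl (heq_of_eq (h3 : (GElt.top : GElt.{u} 0) = GElt.one))
  · intro hA
    have hA : Subsingleton A.carrier := hA
    exact ⟨SP_subset_V _ fun _ _ _ => Subsingleton.elim _ _,
      SP_subset_V _ fun _ _ _ => Subsingleton.elim _ _⟩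

end Girales

/-! ### Stone duality, Boolean powers and the image of `Heyt`. -/

namespace Girales

/-- Two-valued homomorphisms of Heyting algebras. -/
structure IsValuation (B : UAlg.{u} heytType) (e : B.carrier → Prop) : Prop where
  join : ∀ a b, e (hjoin B a b) ↔ e a ∨ e b
  meet : ∀ a b, e (hmeet B a b) ↔ e a ∧ e b
  imp : ∀ a b, e (himp B a b) ↔ (e a → e b)
  bot : ¬ e (hbot B)
  one : e (hone B)

/-- A Heyting algebra in the sense of Mathlib, without the bottom element. -/
abbrev IsHeyting.generalizedHeytingAlgebra {B : UAlg.{u} heytType} (h : IsHeyting B) :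
    GeneralizedHeytingAlgebra B.carrier :=
  letI : Max B.carrier := ⟨hjoin B⟩
  letI : Min B.carrier := ⟨hmeet B⟩
  letI L : Lattice B.carrier := Lattice.mk' h.join_comm h.join_assoc h.meet_comm h.meet_assoc
    h.join_meet_self h.meet_join_self
  have le_iff : ∀ a b : B.carrier, a ≤ b ↔ hle B a b := fun _ _ => inf_eq_left.symm
  { L with
    top := hone B
    le_top := fun a => (le_iff _ _).2 (h.le_one a)
    himp := himp B
    le_himp_iff := fun a b c => by
      rw [le_iff, le_iff]
      exact (h.residuation a b c).symm }

/-- The two-valued homomorphisms separate the points of a Boolean algebra. -/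
theorem IsBooleanAlg.eq_of_forall_valuation {B : UAlg.{u} heytType} (hB : IsBooleanAlg B)
    {x y : B.carrier} (hxy : ∀ e, IsValuation B e → (e x ↔ e y)) : x = y := by
  let := hB.1.generalizedHeytingAlgebra
  have bot_le : ∀ a : B.carrier, hbot B ≤ a := fun a => inf_eq_left.1 (hB.1.bot_le a)
  suffices h : ∀ x y : B.carrier, ¬ x ≤ y → ∃ e, IsValuation B e ∧ e x ∧ ¬ e y by
    by_contra hne
    rcases not_and_or.1 (mt (fun h => le_antisymm h.1 h.2) hne) with h1 | h1
    · obtain ⟨e, he, hx, hy⟩ := h _ _ h1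
      exact hy ((hxy e he).1 hx)
    · obtain ⟨e, he, hx, hy⟩ := h _ _ h1
      exact hy ((hxy e he).2 hx)
  intro x y hxy
  -- The valuation will be the complement of a prime ideal that contains `y` and avoids `x`.
  have hd : Disjoint (Order.PFilter.principal x : Set B.carrier) (Order.Ideal.principal y) := by
    rw [Set.disjoint_left]
    intro z hz1 hz2
    exact hxy (le_trans (Order.PFilter.mem_principal.1 hz1) (Order.Ideal.mem_principal.1 hz2))
  obtain ⟨J, hJ, hyJ, hxJ⟩ := DistribLattice.prime_ideal_of_disjoint_filter_ideal hd
  have hx : x ∉ J := Set.disjoint_left.1 hxJ (Order.PFilter.mem_principal.2 le_rfl)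
  have hy : y ∈ J := hyJ (Order.Ideal.mem_principal.2 le_rfl)
  have hone : (⊤ : B.carrier) ∉ J := fun h => hx (J.lower le_top h)
  have hbJ : hbot B ∈ J := J.lower (bot_le y) hy
  have hmeet : ∀ a b : B.carrier, a ⊓ b ∈ J ↔ a ∈ J ∨ b ∈ J := fun a b =>
    ⟨hJ.mem_or_mem, fun h => h.elim (J.lower inf_le_left) (J.lower inf_le_right)⟩
  have hjoin : ∀ a b : B.carrier, a ⊔ b ∈ J ↔ a ∈ J ∧ b ∈ J := fun a b =>
    Order.Ideal.sup_mem_iff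
  refine ⟨fun b => b ∉ J, ⟨fun a b => ?_, fun a b => ?_, fun a b => ?_, not_not.2 hbJ, hone⟩, hx,
    not_not.2 hy⟩
  · rw [show Girales.hjoin B a b = a ⊔ b from rfl, hjoin, not_and_or]
  · rw [show Girales.hmeet B a b = a ⊓ b from rfl, hmeet, not_or]
  · show a ⇨ b ∉ J ↔ _
    constructor
    · intro h ha hb
      have h1 : a ⊓ (a ⇨ b) ∈ J := J.lower inf_himp_le hb
      exact ((hmeet _ _).1 h1).elim ha h
    · intro h hab
      have hb : b ∈ J := J.lower le_himp hab
      have ha : a ∈ J := by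
        by_contra ha
        exact h ha hb
      -- The only use of excluded middle in `B`: with `a` and `a ⇨ b` in `J`, also `a ⇨ ⊥ ≤ a ⇨ b`
      -- is in `J`, hence so is `⊤`.
      have h1 : a ⊔ (a ⇨ hbot B) = ⊤ := hB.2 a
      refine hone (h1 ▸ (hjoin _ _).2 ⟨ha, J.lower (himp_le_himp_left (bot_le b)) hab⟩)

/-- The points of the dual space of a Boolean algebra. -/
abbrev Valuation (B : UAlg.{u} heytType) : Type u := {e : B.carrier → Prop // IsValuation B e}

/-- The sets of valuations that are given by an element of the Boolean algebra. -/
def IsRepresented (B : UAlg.{u} heytType) (p : Valuation B → Prop) : Prop :=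
  ∃ b, ∀ e : Valuation B, p e ↔ e.1 b

namespace IsRepresented

variable {B : UAlg.{u} heytType} {p q : Valuation B → Prop}

theorem const (P : Prop) : IsRepresented B fun _ => P := by
  by_cases hP : P
  · exact ⟨hone B, fun e => iff_of_true hP e.2.one⟩
  · exact ⟨hbot B, fun e => iff_of_false hP e.2.bot⟩

theorem and (hp : IsRepresented B p) (hq : IsRepresented B q) :
    IsRepresented B fun e => p e ∧ q e := by
  obtain ⟨a, ha⟩ := hp
  obtain ⟨b, hb⟩ := hq
  exact ⟨hmeet B a b, fun e => by simp only [e.2.meet, ha, hb]⟩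

theorem or (hp : IsRepresented B p) (hq : IsRepresented B q) :
    IsRepresented B fun e => p e ∨ q e := by
  obtain ⟨a, ha⟩ := hp
  obtain ⟨b, hb⟩ := hq
  exact ⟨hjoin B a b, fun e => by simp only [e.2.join, ha, hb]⟩

theorem not (hp : IsRepresented B p) : IsRepresented B fun e => ¬ p e := by
  obtain ⟨a, ha⟩ := hp
  exact ⟨himp B a (hbot B), fun e => by simp only [e.2.imp, ha, e.2.bot, imp_false]⟩

theorem forall_finite {ι : Type*} [Finite ι] {p : ι → Valuation B → Prop}
    (hp : ∀ i, IsRepresented B (p i)) : IsRepresented B fun e => ∀ i, p i e := by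
  classical
  have := Fintype.ofFinite ι
  suffices h : ∀ s : Finset ι, IsRepresented B fun e => ∀ i ∈ s, p i e by
    simpa using h Finset.univ
  intro s
  induction s using Finset.induction_on with
  | empty => simpa using const True
  | insert a s _ ih => simpa only [Finset.forall_mem_insert] using (hp a).and ih

theorem exists_finite {ι : Type*} [Finite ι] {p : ι → Valuation B → Prop}
    (hp : ∀ i, IsRepresented B (p i)) : IsRepresented B fun e => ∃ i, p i e := by
  simpa only [not_forall, not_not] using (forall_finite fun i => (hp i).not).not

end IsRepresented

/-- The Boolean power of a finite algebra: the continuous functions on the dual space of a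
Boolean algebra. -/
def booleanPower {σ : AlgType} (G : UAlg.{u} σ) (hG : Finite G.carrier) (B : UAlg.{u} heytType) :
    UAlg.{u} σ where
  carrier := {f : Valuation B → G.carrier // ∀ g, IsRepresented B fun e => f e = g}
  op s x := ⟨fun e => G.op s fun j => (x j).1 e, fun g => by
    -- A fibre of the result is a finite union, over the argument tuples with value `g`, of finite
    -- intersections of fibres of the arguments.
    have h1 : ∀ e, G.op s (fun j => (x j).1 e) = g ↔
        ∃ t : {t : Fin (σ.arity s) → G.carrier // G.op s t = g}, ∀ j, (x j).1 e = t.1 j := fun e =>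
      ⟨fun h => ⟨⟨_, h⟩, fun _ => rfl⟩, fun ⟨t, ht⟩ => by rw [← t.2, funext ht]⟩
    simp only [h1]
    exact .exists_finite fun t => .forall_finite fun j => (x j).2 _⟩

/-- Evaluations at valuations are homomorphisms into `G` and separate points. -/
theorem booleanPower_mem_V {σ : AlgType} (G : UAlg.{u} σ) (hG : Finite G.carrier)
    (B : UAlg.{u} heytType) : booleanPower G hG B ∈ V G :=
  SP_subset_V G fun _ _ h => Subtype.ext (funext fun e => h (fun f => f.1 e) fun _ _ => rfl)

theorem IsDiscriminatorGirale.truthValue_bang_eq_one {G : UAlg.{u} giraleType}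
    (hG : IsDiscriminatorGirale G) (x : G.carrier) :
    truthValue G (bang G x = one G) = bang G x := by
  obtain ⟨P, hP⟩ := hG.bang_eq x
  rw [hP, ← truthValue_true G, hG.truthValue_inj, hG.truthValue_inj, iff_true]

/-- Every Boolean algebra is the Boolean algebra of a Boolean power of a discriminator girale. -/
theorem IsDiscriminatorGirale.iso_bangAlg_booleanPower {G : UAlg.{u} giraleType}
    (hG : IsDiscriminatorGirale G) {B : UAlg.{u} heytType} (hB : IsBooleanAlg B)
    (h : IsGirale (booleanPower G hG.finite B)) :
    Iso B (bangAlg (booleanPower G hG.finite B) h) := by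
  have hrep : ∀ b g, IsRepresented B fun e => truthValue G (e.1 b) = g := fun b g => by
    have h1 : ∀ e : Valuation B, truthValue G (e.1 b) = g ↔
        (e.1 b ∧ one G = g) ∨ (¬ e.1 b ∧ bang G (zero G) = g) := fun e => by
      by_cases hb : e.1 b <;> simp [hb, truthValue_true, truthValue_false]
    simp only [h1]
    have hb : IsRepresented B fun e => e.1 b := ⟨b, fun _ => Iff.rfl⟩
    exact (hb.and (.const _)).or (hb.not.and (.const _))
  have hp : ∀ e, IsHom (booleanPower G hG.finite B) G (fun f => f.1 e) := fun _ _ _ => rfl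
  -- The characteristic function of the clopen set of `b`, with values `1` and `!0`.
  let c : B.carrier → (booleanPower G hG.finite B).carrier := fun b =>
    ⟨fun e => truthValue G (e.1 b), hrep b⟩
  have hc : ∀ b, bang _ (c b) = c b := fun b => Subtype.ext (funext fun e => by
    exact ((hp e).bang _).trans (hG.bang_truthValue _))
  refine ⟨fun b => ⟨c b, c b, hc b⟩, fun s x => Subtype.ext (Subtype.ext (funext fun e => ?_)),
    fun a b hab => ?_, fun ⟨u, f, hf⟩ => ?_⟩
  · have pair : ∀ x : Fin 2 → B.carrier, ∃ a b, x = ![a, b] := fun x =>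
      ⟨x 0, x 1, by funext i; fin_cases i <;> rfl⟩
    have nil : ∀ x : Fin 0 → B.carrier, x = ![] := fun x => funext fun i => i.elim0
    cases s
    · obtain ⟨a, b, rfl⟩ := pair x
      refine Eq.trans ?_ (((hp e).join (c a) (c b)).trans (hG.join_truthValue _ _)).symm
      exact congrArg (truthValue G) (propext (e.2.join a b))
    · obtain ⟨a, b, rfl⟩ := pair x
      refine Eq.trans ?_ (((hp e).bang _).trans ((congrArg _ ((hp e).meet (c a) (c b))).trans
        (hG.meet_truthValue _ _))).symm
      exact congrArg (truthValue G) (propext (e.2.meet a b))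
    · obtain ⟨a, b, rfl⟩ := pair x
      refine Eq.trans ?_ (((hp e).bang _).trans ((congrArg _ ((hp e).imp (c a) (c b))).trans
        (hG.imp_truthValue _ _))).symm
      exact congrArg (truthValue G) (propext (e.2.imp a b))
    · obtain rfl := nil x
      refine Eq.trans ?_ (((hp e).bang _).trans (congrArg _ (hp e).zero)).symm
      exact (congrArg (truthValue G) (eq_false e.2.bot)).trans (truthValue_false G)
    · obtain rfl := nil x
      refine Eq.trans ?_ (hp e).one.symm
      exact (congrArg (truthValue G) (eq_true e.2.one)).trans (truthValue_true G)
  · refine hB.eq_of_forall_valuation fun e he => hG.truthValue_inj.1 ?_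
    have h1 : c a = c b := congrArg Subtype.val hab
    exact congrFun (congrArg Subtype.val h1) ⟨e, he⟩
  -- An element `u = !f` has only the values `1` and `!0`, so it is the characteristic function of
  -- the clopen set where it is `1`; `b` represents that set.
  · obtain ⟨b, hb⟩ := u.2 (one G)
    refine ⟨b, Subtype.ext (Subtype.ext (funext fun e => ?_))⟩
    show truthValue G (e.1 b) = u.1 e
    have h1 : u.1 e = bang G (f.1 e) := (congrArg (fun v => v.1 e) hf).symm.trans ((hp e).bang f)
    have h2 : e.1 b ↔ bang G (f.1 e) = one G := by rw [← h1]; exact (hb e).symm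
    rw [h1, h2, hG.truthValue_bang_eq_one]

theorem IsDiscriminatorGirale.Heyt_V {G : UAlg.{u} giraleType} (hG : IsDiscriminatorGirale G) :
    Heyt (V G) = BooleanAlgs := by
  ext B
  constructor
  · rintro ⟨A, hA, h, hiso⟩
    obtain ⟨_, hb⟩ := hG.isBooleanGirale_of_mem_V hA
    exact IsBooleanAlg.of_iso hiso hb
  · intro hB
    have hmem := booleanPower_mem_V G hG.finite B
    exact ⟨_, hmem, hG.isGiraleVariety_V.2 _ hmem, hG.iso_bangAlg_booleanPower hB _⟩

theorem Heyt_trivialClass : Heyt (trivialClass.{u} giraleType) = trivialClass heytType := by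
  ext B
  constructor
  · rintro ⟨A, hA, h, φ, _, hφ⟩
    have hA : Subsingleton A.carrier := hA
    exact ⟨fun x y => hφ.1 (Subtype.ext (Subsingleton.elim _ _))⟩
  · intro hB
    have hB : Subsingleton B.carrier := hB
    let T : UAlg.{u} giraleType := ⟨PUnit, fun _ _ => PUnit.unit⟩
    have hT : Subsingleton T.carrier := inferInstanceAs (Subsingleton PUnit)
    -- A one-element algebra is separated vacuously, so it inherits the girale axioms.
    have hg : IsGirale T := isGirale_twoAlg.of_mem_SP fun _ _ _ => Subsingleton.elim _ _
    refine ⟨T, hT, hg, fun _ => hone _, fun _ _ => Subtype.ext (Subsingleton.elim _ _),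
      fun _ _ _ => Subsingleton.elim _ _,
      fun _ => ⟨hone B, Subtype.ext (Subsingleton.elim _ _)⟩⟩

/-- The witness is the Boolean algebra `!(G 1)`, in which `!0 ≠ 1`. -/
theorem booleanAlgs_ne_trivialClass : BooleanAlgs.{u} ≠ trivialClass heytType := by
  intro e
  have hG := isDiscriminatorGirale_twoAlg.{u}
  obtain ⟨h1, h2⟩ := hG.isBooleanGirale
  have h3 : bangAlg twoAlg h1 ∈ trivialClass heytType := e ▸ h2
  have h4 : Subsingleton (bangAlg twoAlg h1).carrier := h3
  exact hG.bang_zero_ne_one (congrArg Subtype.val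
    (Subsingleton.elim (hbot (bangAlg twoAlg h1)) (hone _)))

end Girales

theorem mainTheorem8 :
    -- every `G n` is a finite simple Boolean girale; the number of elements is unbounded
    (∀ n : ℕ, 1 ≤ n →
      IsBooleanGirale (Girales.G.{u} n) ∧ IsSimpleAlg (Girales.G.{u} n) ∧
        Finite (Girales.G.{u} n).carrier) ∧
    (∀ n : ℕ, 2 ≤ n → Nat.card (Girales.G.{u} n).carrier = n + 2) ∧
    -- `V(G n)` is a Boolean variety of girales
    (∀ n : ℕ, 1 ≤ n →
      IsGiraleVariety (Girales.V (Girales.G.{u} n)) ∧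
        ∀ A ∈ Girales.V (Girales.G.{u} n), IsBooleanGirale A) ∧
    -- the subdirectly irreducible algebras in `V(G n)`
    (∀ n : ℕ, 2 ≤ n → ∀ A : UAlg.{u} giraleType,
      (A ∈ Girales.V (Girales.G.{u} n) ∧ IsSubdirectlyIrreducible A) ↔
        ∃ m : ℕ, 2 ≤ m ∧ m ≤ n ∧ Girales.Iso A (Girales.G.{u} m)) ∧
    (∀ A : UAlg.{u} giraleType,
      (A ∈ Girales.V (Girales.G.{u} 1) ∧ IsSubdirectlyIrreducible A) ↔
        Girales.Iso A (Girales.G.{u} 1)) ∧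
    -- the `G n` are pairwise nonisomorphic and generate distinct varieties
    (∀ m n : ℕ, 1 ≤ m → 1 ≤ n → m ≠ n →
      ¬ Girales.Iso (Girales.G.{u} m) (Girales.G.{u} n) ∧
        Girales.V (Girales.G.{u} m) ≠ Girales.V (Girales.G.{u} n)) ∧
    -- `V(G 1)` and `V(G 2)` are atoms with trivial intersection, but have the same `Heyt` image
    IsAtomVariety (Girales.V (Girales.G.{u} 1)) ∧
    IsAtomVariety (Girales.V (Girales.G.{u} 2)) ∧
    Girales.V (Girales.G.{u} 1) ∩ Girales.V (Girales.G.{u} 2) = trivialClass giraleType ∧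
    IsVariety BooleanAlgs.{u} ∧
    Heyt (Girales.V (Girales.G.{u} 1)) = BooleanAlgs ∧
    Heyt (Girales.V (Girales.G.{u} 2)) = BooleanAlgs ∧
    Heyt (Girales.V (Girales.G.{u} 1) ∩ Girales.V (Girales.G.{u} 2)) = trivialClass heytType ∧
    Heyt (Girales.V (Girales.G.{u} 1) ∩ Girales.V (Girales.G.{u} 2)) ≠
      Heyt (Girales.V (Girales.G.{u} 1)) ∩ Heyt (Girales.V (Girales.G.{u} 2)) ∧
    -- `Heyt` is not a meet-homomorphism
    ¬ (∀ K L : Set (UAlg.{u} giraleType), IsGiraleVariety K → IsGiraleVariety L →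
      Heyt (K ∩ L) = Heyt K ∩ Heyt L) := by
  have h1 := isDiscriminatorGirale_G.{u} le_rfl
  have h2 := isDiscriminatorGirale_G.{u} one_le_two
  have hne : Heyt (Girales.V (Girales.G.{u} 1) ∩ Girales.V (Girales.G.{u} 2)) ≠
      Heyt (Girales.V (Girales.G.{u} 1)) ∩ Heyt (Girales.V (Girales.G.{u} 2)) := by
    rw [h1.Heyt_V, h2.Heyt_V, Set.inter_self, V_G_one_inter_V_G_two, Heyt_trivialClass]
    exact booleanAlgs_ne_trivialClass.symm
  refine ⟨fun n hn => ?_, fun n hn => card_G hn, fun n hn => ?_,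
    fun n hn A => mem_V_G_and_isSubdirectlyIrreducible_iff hn A,
    mem_V_G_one_and_isSubdirectlyIrreducible_iff,
    fun m n hm hn hmn => ⟨fun h => hmn (eq_of_iso_G hm hn h), fun h => hmn (eq_of_V_G_eq hm hn h)⟩,
    h1.isAtomVariety_V fun _ _ => surjective_of_isHom_G_one,
    h2.isAtomVariety_V fun _ _ => surjective_of_isHom_G_two,
    V_G_one_inter_V_G_two, isVariety_booleanAlgs, h1.Heyt_V, h2.Heyt_V, ?_, hne,
    fun h => hne (h _ _ h1.isGiraleVariety_V h2.isGiraleVariety_V)⟩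
  · have h := isDiscriminatorGirale_G.{u} hn
    exact ⟨h.isBooleanGirale, h.isSimpleAlg, h.finite⟩
  · have h := isDiscriminatorGirale_G.{u} hn
    exact ⟨h.isGiraleVariety_V, fun _ => h.isBooleanGirale_of_mem_V⟩
  · rw [V_G_one_inter_V_G_two, Heyt_trivialClass]
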